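/- Let $S$ be a left cancellative monoid with identity $e$. **Notation.** Let $I_\ell(S)$ be the left inverse hull of $S$, i.e. the inverse semigroup of partial bijections of $S$ generated by the left translations $t\mapsto st$, $s\in S$. Let $\mathcal J(S)$ be the set of constructible ideals, i.e. of the domains $X\subset S$ of the idempotents $p_X$ of $I_\ell(S)$, and let $\bar{\mathcal J}(S)$ be the set of all sets $X\setminus(X_1\cup\dots\cup X_m)$ with $m\ge 0$ and $X,X_1,\dots,X_m\in\mathcal J(S)$. Let $E(S)=\{p_X\mid X\in\mathcal J(S)\}$ be the semilattice of idempotents, and let $\widehat{E(S)}$ be the space of its semi-characters (semigroup homomorphisms $E(S)\to\{0,1\}$ that are not identically zero) with the topology of pointwise convergence. For $s\in S$ put $\chi_s(p_X)=\mathbf 1_X(s)$, and let $\Omega(S)$ be the closure of $\{\chi_s\mid s\in S\}$ in $\widehat{E(S)}$. Every $\chi\in\Omega(S)$ extends to $\bar{\mathcal J}(S)$: $\chi(p_{X\setminus(X_1\cup\dots\cup X_m)})=1$ if $\chi(p_X)=1$ and $\chi(p_{X_i})=0$ for all $i$, and it is $0$ otherwise. Let $\mathcal G(S)$ be Spielberg's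 groupoid: its elements are the classes $[g,\chi]$ of pairs $(g,\chi)\in I_\ell(S)\times\Omega(S)$ with $\chi(g^{-1}g)=1$, where $(g,\chi)\sim(h,\psi)$ iff $\chi=\psi$ and there is $A\in\bar{\mathcal J}(S)$ with $\chi(p_A)=1$ and $g|_A=h|_A$; the source of $[g,\chi]$ is $\chi$, its range is $\chi(g^{-1}\cdot g)$, the product is $[g,\chi][h,\psi]=[gh,\psi]$ when $\chi=\psi(h^{-1}\cdot h)$, the inverse is $[g,\chi]^{-1}=[g^{-1},\chi(g^{-1}\cdot g)]$, and a basis of the topology is given by the sets $D(g,U)=\{[g,\chi]\mid\chi\in U\}$ with $U$ an open subset of $\{\chi\in\Omega(S)\mid\chi(g^{-1}g)=1\}$. It is a locally compact, not necessarily Hausdorff, étale groupoid with unit space $\Omega(S)$. For such a groupoid $\mathcal G$, $C_c(\mathcal G)$ is the linear span of the spaces $C_c(V)$, extended by zero, over all open Hausdorff subsets $V\subset\mathcal G$. For a unit $x$ and $\mathcal G_x=s^{-1}(x)$, the representation $\rho_x$ of $C_c(\mathcal G)$ on $\ell^2(\mathcal G_x)$ is given by $(\rho_x(f)\xi)(g)=\sum_{h:\,r(h)=r(g)}f(h)\xi(h^{-1}g)$,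 and $C^*_r(\mathcal G)$ is the completion of $C_c(\mathcal G)$ in the norm $\|f\|_r=\sup_x\|\rho_x(f)\|$, to which each $\rho_x$ extends. Finally, $C^*_r(S)\subset B(\ell^2(S))$ is the C$^*$-algebra generated by the operators $\lambda_s$, $\lambda_s\delta_t=\delta_{st}$, $s\in S$. The monoid $S$ is called *C$^*$-regular* if, given $h_1,\dots,h_n\in I_\ell(S)$ and $X\in\bar{\mathcal J}(S)$ with $$\emptyset\ne X\subset\bigcup_{k=1}^n\{s\in S: h_ks=s\},$$ there are $Y_1,\dots,Y_l\in\bar{\mathcal J}(S)$ and indices $1\le k_j\le n$ ($1\le j\le l$) such that $$X\subset\bigcup_{j=1}^lY_j\qquad\text{and}\qquad h_{k_j}|_{Y_j}=\mathrm{id}\quad\text{for all }j.$$ **Proposition.** If $S$ is C$^*$-regular, then $\rho_{\chi_e}$ defines an isomorphism $C^*_r(\mathcal G(S))\cong C^*_r(S)$. More precisely, there is a (unique) unitary $U\colon\ell^2(S)\to\ell^2(\mathcal G(S)_{\chi_e})$ with $U\delta_s=\delta_{[s,\chi_e]}$ for all $s\in S$, where $s$ is viewed as the left translation by $s$ in $I_\ell(S)$,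 and $a\mapsto U^*\rho_{\chi_e}(a)U$ is a $*$-isomorphism of $C^*_r(\mathcal G(S))$ onto $C^*_r(S)$. -/

import Mathlib

open scoped ENNReal Topology

namespace SemigroupCStar

/-! ### Étale groupoids and their reduced C*-algebras -/

/-- A groupoid, given by its set `G` of arrows and its set `X` of units. The product `mul g h` is
the groupoid product when `src g = rng h`; its value on other pairs carries no information. -/
class ArrowGroupoid (G : Type*) (X : outParam Type*) where
  src : G → X
  rng : G → X
  unit : X → G
  inv : G → G
  mul : G → G → G
  src_unit : ∀ x, src (unit x) = x
  rng_unit : ∀ x, rng (unit x) = x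
  src_inv : ∀ g, src (inv g) = rng g
  rng_inv : ∀ g, rng (inv g) = src g
  src_mul : ∀ g h, src g = rng h → src (mul g h) = src h
  rng_mul : ∀ g h, src g = rng h → rng (mul g h) = rng g
  assoc : ∀ g h k, src g = rng h → src h = rng k → mul (mul g h) k = mul g (mul h k)
  unit_mul : ∀ g, mul (unit (rng g)) g = g
  mul_unit : ∀ g, mul g (unit (src g)) = g
  inverse_mul : ∀ g, mul (inv g) g = unit (src g)
  mul_inverse : ∀ g, mul g (inv g) = unit (rng g)

/-- A locally compact, not necessarily Hausdorff, étale groupoid: the operations are continuous,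
the unit space is locally compact Hausdorff in the relative topology, and the source and range maps
are local homeomorphisms (so that the arrow space is automatically locally compact). -/
class EtaleGroupoid (G : Type*) (X : outParam Type*) [TopologicalSpace G] [TopologicalSpace X]
    extends ArrowGroupoid G X where
  continuous_inv : Continuous inv
  continuous_mul : Continuous fun p : {p : G × G // src p.1 = rng p.2} => mul p.1.1 p.1.2
  unit_isEmbedding : Topology.IsEmbedding unit
  t2_units : T2Space X
  locallyCompact_units : LocallyCompactSpace X
  src_isLocalHomeomorph : IsLocalHomeomorph src
  rng_isLocalHomeomorph : IsLocalHomeomorph rng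

/-- The Hilbert space `ℓ²(ι)`. -/
abbrev L2 (ι : Type*) : Type _ := lp (fun _ : ι => ℂ) 2

open Classical in
/-- The basis vector `δ_i` of `ℓ²(ι)`. -/
noncomputable def delta {ι : Type*} (i : ι) : L2 ι := lp.single 2 i (1 : ℂ)

/-- A complex matrix whose entries are bounded and whose rows and columns have boundedly many
nonzero entries acts boundedly on `ℓ²`. -/
theorem kernel_sum_le {ι : Type*} (A : ι → ι → ℂ) (N : ℕ) (C : ℝ)
    (hA : ∀ i j, ‖A i j‖ ≤ C) (hrow : ∀ i, {j | A i j ≠ 0}.encard ≤ N)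
    (hcol : ∀ j, {i | A i j ≠ 0}.encard ≤ N) (ξ : L2 ι) (s : Finset ι) :
    ∑ i ∈ s, ‖∑' j, A i j * ξ j‖ ^ (2 : ℝ≥0∞).toReal
      ≤ ((N * C) * ‖ξ‖) ^ (2 : ℝ≥0∞).toReal := by
  classical
  simp only [ENNReal.toReal_ofNat, Real.rpow_two]
  have hfin : ∀ i, {j | A i j ≠ 0}.Finite := fun i =>
    Set.finite_of_encard_le_coe (hrow i)
  set R : ι → Finset ι := fun i => (hfin i).toFinset with hR
  have hmemR : ∀ i j, j ∈ R i ↔ A i j ≠ 0 := fun i j => by simp [hR]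
  have hcardR : ∀ i, (R i).card ≤ N := fun i => by
    have h1 := hrow i
    rw [(hfin i).encard_eq_coe_toFinset_card] at h1
    exact_mod_cast h1
  have htsum : ∀ i, ∑' j, A i j * ξ j = ∑ j ∈ R i, A i j * ξ j := fun i => by
    refine tsum_eq_sum fun j hj => ?_
    have : A i j = 0 := by
      by_contra h
      exact hj ((hmemR i j).2 h)
    simp [this]
  have hterm : ∀ i, ‖∑' j, A i j * ξ j‖ ^ 2 ≤ (N * C ^ 2) * ∑ j ∈ R i, ‖ξ j‖ ^ 2 := fun i => by
    rw [htsum]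
    calc ‖∑ j ∈ R i, A i j * ξ j‖ ^ 2 ≤ (∑ j ∈ R i, C * ‖ξ j‖) ^ 2 := by
          gcongr
          refine (norm_sum_le _ _).trans (Finset.sum_le_sum fun j _ => ?_)
          rw [norm_mul]
          gcongr
          exact hA i j
      _ ≤ (R i).card * ∑ j ∈ R i, (C * ‖ξ j‖) ^ 2 := sq_sum_le_card_mul_sum_sq
      _ ≤ N * ∑ j ∈ R i, (C * ‖ξ j‖) ^ 2 := by
          gcongr
          exact hcardR i
      _ = _ := by
          simp only [mul_pow, ← Finset.mul_sum]
          ring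
  have hcount : ∀ j, ((s.filter fun i => j ∈ R i).card : ℝ) ≤ N := fun j => by
    have h1 : ((s.filter fun i => j ∈ R i).card : ℕ∞) ≤ N := by
      rw [← Set.encard_coe_eq_coe_finsetCard]
      refine (Set.encard_le_encard ?_).trans (hcol j)
      intro i hi
      exact (hmemR i j).1 (Finset.mem_filter.1 hi).2
    exact_mod_cast h1
  calc ∑ i ∈ s, ‖∑' j, A i j * ξ j‖ ^ 2
      ≤ ∑ i ∈ s, (N * C ^ 2) * ∑ j ∈ R i, ‖ξ j‖ ^ 2 := Finset.sum_le_sum fun i _ => hterm i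
    _ = (N * C ^ 2) * ∑ i ∈ s, ∑ j ∈ R i, ‖ξ j‖ ^ 2 := by rw [Finset.mul_sum]
    _ = (N * C ^ 2) * ∑ j ∈ s.biUnion R, ∑ i ∈ s.filter (fun i => j ∈ R i), ‖ξ j‖ ^ 2 := by
        congr 1
        refine Finset.sum_comm' fun i j => ?_
        simp only [Finset.mem_filter, Finset.mem_biUnion]
        constructor
        · rintro ⟨h1, h2⟩
          exact ⟨⟨h1, h2⟩, i, h1, h2⟩
        · rintro ⟨h1, -⟩
          exact h1
    _ ≤ (N * C ^ 2) * ∑ j ∈ s.biUnion R, N * ‖ξ j‖ ^ 2 := by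
        gcongr with j _
        rw [Finset.sum_const, nsmul_eq_mul]
        exact mul_le_mul_of_nonneg_right (hcount j) (by positivity)
    _ = (N * C) ^ 2 * ∑ j ∈ s.biUnion R, ‖ξ j‖ ^ 2 := by
        rw [← Finset.mul_sum]
        ring
    _ ≤ (N * C) ^ 2 * ‖ξ‖ ^ 2 := by
        gcongr
        have := lp.sum_rpow_le_norm_rpow (p := 2) (by simp) ξ (s.biUnion R)
        simpa using this
    _ = _ := by ring

section General

variable {G X : Type*}

open ArrowGroupoid

/-- The set `G_x` of arrows with source `x`. -/
abbrev SrcFiber (G : Type*) {X : Type*} [ArrowGroupoid G X] (x : X) : Type _ :=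
  {g : G // src g = x}

/-- The set `G^x` of arrows with range `x`. -/
abbrev RngFiber (G : Type*) {X : Type*} [ArrowGroupoid G X] (x : X) : Type _ :=
  {g : G // rng g = x}

theorem src_inv_mul [ArrowGroupoid G X] {x : X} (g : SrcFiber G x) (h : RngFiber G (rng g.1)) :
    src (mul (inv h.1) g.1) = x := by
  rw [src_mul _ _ (by rw [src_inv, h.2]), g.2]

/-- The formula `∑_{h ∈ G^{r(g)}} f(h) ξ(h⁻¹g)`. -/
noncomputable def convFormula [ArrowGroupoid G X] (f : G → ℂ) (x : X) (ξ : SrcFiber G x → ℂ)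
    (g : SrcFiber G x) : ℂ :=
  ∑' h : RngFiber G (rng g.1), f h.1 * ξ ⟨mul (inv h.1) g.1, src_inv_mul g h⟩

/-- The bijection `G^{r(g)} → G_x`, `h ↦ h⁻¹g`, for `g ∈ G_x`. -/
def fiberEquiv [ArrowGroupoid G X] {x : X} (g : SrcFiber G x) :
    RngFiber G (rng g.1) ≃ SrcFiber G x where
  toFun h := ⟨mul (inv h.1) g.1, src_inv_mul g h⟩
  invFun k := ⟨mul g.1 (inv k.1), by rw [rng_mul _ _ (by rw [rng_inv, g.2, k.2])]⟩
  left_inv h := by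
    obtain ⟨h, hh⟩ := h
    obtain ⟨g, hg⟩ := g
    simp only [Subtype.mk.injEq] at hh ⊢
    have e1 : src (inv h) = rng g := by rw [src_inv, hh]
    have e2 : src g = rng (inv (mul (inv h) g)) := by rw [rng_inv, src_mul _ _ e1]
    calc mul g (inv (mul (inv h) g))
        = mul (mul (unit (rng g)) g) (inv (mul (inv h) g)) := by rw [unit_mul]
      _ = mul (mul (mul h (inv h)) g) (inv (mul (inv h) g)) := by rw [mul_inverse, hh]
      _ = mul (mul h (mul (inv h) g)) (inv (mul (inv h) g)) := by
          rw [assoc h (inv h) g (by rw [rng_inv]) e1]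
      _ = mul h (mul (mul (inv h) g) (inv (mul (inv h) g))) := by
          rw [assoc h _ _ (by rw [rng_mul _ _ e1, rng_inv]) (by rw [rng_inv])]
      _ = mul h (unit (src h)) := by rw [mul_inverse, rng_mul _ _ e1, rng_inv]
      _ = h := mul_unit h
  right_inv k := by
    obtain ⟨k, hk⟩ := k
    obtain ⟨g, hg⟩ := g
    simp only [Subtype.mk.injEq]
    have e1 : src g = rng (inv k) := by rw [rng_inv, hk, hg]
    have e3 : src (inv (mul g (inv k))) = rng g := by rw [src_inv, rng_mul _ _ e1]
    calc mul (inv (mul g (inv k))) g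
        = mul (inv (mul g (inv k))) (mul g (unit (src g))) := by rw [mul_unit]
      _ = mul (inv (mul g (inv k))) (mul g (mul (inv k) k)) := by rw [inverse_mul, hk, hg]
      _ = mul (inv (mul g (inv k))) (mul (mul g (inv k)) k) := by
          rw [assoc g (inv k) k e1 (src_inv k)]
      _ = mul (mul (inv (mul g (inv k))) (mul g (inv k))) k := by
          exact (assoc _ _ k (by rw [src_inv]) (by rw [src_mul _ _ e1, src_inv])).symm
      _ = mul (unit (rng k)) k := by rw [inverse_mul, src_mul _ _ e1, src_inv]
      _ = k := unit_mul k

theorem convFormula_eq [ArrowGroupoid G X] (f : G → ℂ) (x : X) (ξ : SrcFiber G x → ℂ)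
    (g : SrcFiber G x) :
    convFormula f x ξ g = ∑' k : SrcFiber G x, f (mul g.1 (inv k.1)) * ξ k := by
  rw [← (fiberEquiv g).tsum_eq]
  refine tsum_congr fun h => ?_
  congr 2
  exact congrArg Subtype.val ((fiberEquiv g).symm_apply_apply h).symm

/-- Functions that are bounded and meet every source or range fibre in boundedly many points. -/
def FiberBounded [ArrowGroupoid G X] (f : G → ℂ) : Prop :=
  ∃ (N : ℕ) (C : ℝ), 0 ≤ C ∧ (∀ g, ‖f g‖ ≤ C) ∧
    (∀ x, {g | src g = x ∧ f g ≠ 0}.encard ≤ N) ∧ ∀ x, {g | rng g = x ∧ f g ≠ 0}.encard ≤ N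

theorem FiberBounded.zero [ArrowGroupoid G X] : FiberBounded (0 : G → ℂ) :=
  ⟨0, 0, le_rfl, by simp, by simp, by simp⟩

theorem FiberBounded.smul [ArrowGroupoid G X] {f : G → ℂ} (hf : FiberBounded f) (c : ℂ) :
    FiberBounded (c • f) := by
  obtain ⟨N, C, hC, h1, h2, h3⟩ := hf
  refine ⟨N, ‖c‖ * C, by positivity, fun g => ?_, fun x => ?_, fun x => ?_⟩
  · simp only [Pi.smul_apply, norm_smul]
    gcongr
    exact h1 g
  · refine (Set.encard_le_encard ?_).trans (h2 x)
    rintro g ⟨ha, hb⟩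
    exact ⟨ha, fun h => hb (by simp [h])⟩
  · refine (Set.encard_le_encard ?_).trans (h3 x)
    rintro g ⟨ha, hb⟩
    exact ⟨ha, fun h => hb (by simp [h])⟩

theorem FiberBounded.add [ArrowGroupoid G X] {f f' : G → ℂ} (hf : FiberBounded f)
    (hf' : FiberBounded f') : FiberBounded (f + f') := by
  obtain ⟨N, C, hC, h1, h2, h3⟩ := hf
  obtain ⟨N', C', hC', h1', h2', h3'⟩ := hf'
  have key : ∀ (p : G → Prop), {g | p g ∧ (f + f') g ≠ 0} ⊆
      {g | p g ∧ f g ≠ 0} ∪ {g | p g ∧ f' g ≠ 0} := by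
    rintro p g ⟨ha, hb⟩
    by_cases h : f g = 0
    · refine Or.inr ⟨ha, fun h' => hb (by simp [h, h'])⟩
    · exact Or.inl ⟨ha, h⟩
  refine ⟨N + N', C + C', by positivity, fun g => (norm_add_le _ _).trans
    (add_le_add (h1 g) (h1' g)), fun x => ?_, fun x => ?_⟩
  · refine (Set.encard_le_encard (key _)).trans ((Set.encard_union_le _ _).trans ?_)
    push_cast
    exact add_le_add (h2 x) (h2' x)
  · refine (Set.encard_le_encard (key _)).trans ((Set.encard_union_le _ _).trans ?_)
    push_cast
    exact add_le_add (h3 x) (h3' x)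

/-- Uniform boundedness of the operators `ξ ↦ convFormula f x ξ`. -/
theorem FiberBounded.exists_bound [ArrowGroupoid G X] {f : G → ℂ} (hf : FiberBounded f) :
    ∃ D : ℝ, 0 ≤ D ∧ ∀ (x : X) (ξ : L2 (SrcFiber G x)) (s : Finset (SrcFiber G x)),
      ∑ g ∈ s, ‖convFormula f x ξ g‖ ^ (2 : ℝ≥0∞).toReal ≤ (D * ‖ξ‖) ^ (2 : ℝ≥0∞).toReal := by
  obtain ⟨N, C, hC, h1, h2, h3⟩ := hf
  refine ⟨N * C, by positivity, fun x ξ s => ?_⟩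
  simp only [convFormula_eq]
  have hc : ∀ g k : SrcFiber G x, src g.1 = rng (inv k.1) := fun g k => by
    rw [rng_inv, g.2, k.2]
  refine kernel_sum_le (fun g k : SrcFiber G x => f (mul g.1 (inv k.1))) N C
    (fun _ _ => h1 _) (fun g => ?_) (fun k => ?_) ξ s
  · refine le_trans ?_ (h3 (rng g.1))
    refine Set.encard_le_encard_of_injOn (f := fun k => mul g.1 (inv k.1)) ?_ ?_
    · intro k hk
      exact ⟨rng_mul _ _ (hc g k), hk⟩
    · intro k _ k' _ hkk
      exact (fiberEquiv g).symm.injective (Subtype.ext hkk)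
  · refine le_trans ?_ (h2 (rng k.1))
    refine Set.encard_le_encard_of_injOn (f := fun g => mul g.1 (inv k.1)) ?_ ?_
    · intro g hg
      exact ⟨by rw [src_mul _ _ (hc g k), src_inv], hg⟩
    · intro g _ g' _ hgg
      have aux : ∀ g : SrcFiber G x, mul (mul g.1 (inv k.1)) k.1 = g.1 := fun g => by
        rw [assoc _ _ _ (hc g k) (src_inv _), inverse_mul, k.2]
        have := mul_unit g.1
        rwa [g.2] at this
      have : mul (mul g.1 (inv k.1)) k.1 = mul (mul g'.1 (inv k.1)) k.1 := by
        simp only at hgg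
        rw [hgg]
      rw [aux, aux] at this
      exact Subtype.ext this

/-- The functions on `G` obtained by extending by zero the elements of `C_c(V)`, where `V ⊆ G` is an
open Hausdorff subset. -/
def IsBasicCc [TopologicalSpace G] (f : G → ℂ) : Prop :=
  ∃ V : Set G, IsOpen V ∧ T2Space V ∧ ContinuousOn f V ∧
    ∃ K : Set G, IsCompact K ∧ K ⊆ V ∧ ∀ g ∉ K, f g = 0

/-- The space `C_c(G)` of functions on a not necessarily Hausdorff space: the linear span of the
spaces `C_c(V)` for all open Hausdorff subsets `V`. -/
def Cc (G : Type*) [TopologicalSpace G] : Submodule ℂ (G → ℂ) :=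
  Submodule.span ℂ {f | IsBasicCc f}

variable [TopologicalSpace G] [TopologicalSpace X]

theorem IsBasicCc.fiberBounded [EtaleGroupoid G X] {f : G → ℂ} (hf : IsBasicCc f) :
    FiberBounded f := by
  obtain ⟨V, -, -, hfV, K, hK, hKV, hf0⟩ := hf
  obtain ⟨C, hC⟩ := hK.exists_bound_of_continuousOn (hfV.mono hKV)
  have hloc : ∀ g : G, ∃ U : Set G, IsOpen U ∧ g ∈ U ∧ Set.InjOn src U ∧ Set.InjOn rng U := by
    intro g
    obtain ⟨e, he, hes⟩ := EtaleGroupoid.src_isLocalHomeomorph (G := G) g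
    obtain ⟨e', he', her⟩ := EtaleGroupoid.rng_isLocalHomeomorph (G := G) g
    refine ⟨e.source ∩ e'.source, e.open_source.inter e'.open_source, ⟨he, he'⟩, ?_, ?_⟩
    · rw [hes]
      exact e.injOn.mono Set.inter_subset_left
    · rw [her]
      exact e'.injOn.mono Set.inter_subset_right
  choose U hUo hUm hUs hUr using hloc
  obtain ⟨t, ht⟩ := hK.elim_finite_subcover U hUo fun g _ => Set.mem_iUnion.2 ⟨g, hUm g⟩
  have key : ∀ (p : G → X), (∀ g, Set.InjOn p (U g)) →
      ∀ x, {g | p g = x ∧ f g ≠ 0}.encard ≤ t.card := by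
    intro p hp x
    have hmem : ∀ g ∈ {g | p g = x ∧ f g ≠ 0}, ∃ a ∈ t, g ∈ U a := by
      rintro g ⟨-, hg⟩
      have hgK : g ∈ K := by
        by_contra h
        exact hg (hf0 g h)
      simpa using ht hgK
    choose! a ha ha' using hmem
    rw [← Set.encard_coe_eq_coe_finsetCard]
    refine Set.encard_le_encard_of_injOn (f := a) (fun g hg => ha g hg) ?_
    intro g hg g' hg' h
    refine hp (a g) (ha' g hg) ?_ (hg.1.trans hg'.1.symm)
    have h1 := ha' g' hg'
    rwa [← h] at h1
  refine ⟨t.card, max C 0, le_max_right _ _, fun g => ?_, key _ hUs, key _ hUr⟩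
  by_cases hg : g ∈ K
  · exact (hC g hg).trans (le_max_left _ _)
  · rw [hf0 g hg, norm_zero]
    exact le_max_right _ _

theorem fiberBounded_of_mem_Cc [EtaleGroupoid G X] {f : G → ℂ} (hf : f ∈ Cc G) :
    FiberBounded f := by
  induction hf using Submodule.span_induction with
  | mem f hf => exact IsBasicCc.fiberBounded hf
  | zero => exact FiberBounded.zero
  | add f g _ _ h1 h2 => exact h1.add h2
  | smul c f _ h => exact h.smul c

theorem memℓp_convFormula [EtaleGroupoid G X] (f : Cc G) (x : X) (ξ : L2 (SrcFiber G x)) :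
    Memℓp (convFormula (f : G → ℂ) x ξ) 2 := by
  obtain ⟨D, -, hD⟩ := (fiberBounded_of_mem_Cc f.2).exists_bound
  exact memℓp_gen' (hD x ξ)

theorem summable_convFormula [EtaleGroupoid G X] (f : Cc G) (x : X) (ξ : L2 (SrcFiber G x))
    (g : SrcFiber G x) : Summable fun h : RngFiber G (rng g.1) =>
      (f : G → ℂ) h.1 * ξ ⟨mul (inv h.1) g.1, src_inv_mul g h⟩ := by
  obtain ⟨N, C, -, -, -, h3⟩ := fiberBounded_of_mem_Cc f.2
  have hfin := Set.finite_of_encard_le_coe (h3 (rng g.1))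
  refine summable_of_hasFiniteSupport (Set.Finite.subset
    (hfin.preimage (f := fun h : RngFiber G (rng g.1) => h.1) Subtype.val_injective.injOn) ?_)
  intro h hh
  exact ⟨h.2, fun h0 => hh (by simp [h0])⟩

/-- The representation `ρ_x : C_c(G) → B(ℓ²(G_x))`,
`(ρ_x(f)ξ)(g) = ∑_{h ∈ G^{r(g)}} f(h) ξ(h⁻¹g)`. -/
noncomputable def rho [EtaleGroupoid G X] (x : X) (f : Cc G) :
    L2 (SrcFiber G x) →L[ℂ] L2 (SrcFiber G x) :=
  LinearMap.mkContinuousOfExistsBound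
    { toFun := fun ξ => ⟨convFormula (f : G → ℂ) x ξ, memℓp_convFormula f x ξ⟩
      map_add' := fun ξ η => by
        ext g
        simp only [convFormula, lp.coeFn_add, Pi.add_apply, mul_add]
        exact (summable_convFormula f x ξ g).tsum_add (summable_convFormula f x η g)
      map_smul' := fun c ξ => by
        ext g
        simp only [convFormula, lp.coeFn_smul, Pi.smul_apply, smul_eq_mul, RingHom.id_apply,
          ← tsum_mul_left]
        exact tsum_congr fun h => by ring }
    (by
      obtain ⟨D, hD0, hD⟩ := (fiberBounded_of_mem_Cc f.2).exists_bound
      exact ⟨D, fun ξ => lp.norm_le_of_forall_sum_le (by simp) (by positivity) (hD x ξ)⟩)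

theorem rho_apply [EtaleGroupoid G X] (x : X) (f : Cc G) (ξ : L2 (SrcFiber G x))
    (g : SrcFiber G x) : rho x f ξ g = ∑' h : RngFiber G (rng g.1),
      (f : G → ℂ) h.1 * ξ ⟨mul (inv h.1) g.1, src_inv_mul g h⟩ := rfl

theorem memℓp_rho [EtaleGroupoid G X] (f : Cc G) :
    Memℓp (fun x : X => rho (G := G) x f) ∞ := by
  obtain ⟨D, hD0, hD⟩ := (fiberBounded_of_mem_Cc f.2).exists_bound
  refine memℓp_infty ⟨D, ?_⟩
  rintro _ ⟨x, rfl⟩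
  exact ContinuousLinearMap.opNorm_le_bound _ hD0 fun ξ =>
    lp.norm_le_of_forall_sum_le (by simp) (by positivity) (hD x ξ)

end General

section Reduced

open ArrowGroupoid

/-- The `ℓ^∞`-product of the algebras `B(ℓ²(ι_x))`, `x ∈ X`, with the supremum norm. -/
def OpProduct {X : Type*} (ι : X → Type*) : Type _ :=
  lp (fun x : X => L2 (ι x) →L[ℂ] L2 (ι x)) ∞

namespace OpProduct

variable {X : Type*} (ι : X → Type*)

noncomputable instance : NonUnitalNormedRing (OpProduct ι) :=
  inferInstanceAs (NonUnitalNormedRing (lp (fun x : X => L2 (ι x) →L[ℂ] L2 (ι x)) ∞))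

noncomputable instance : StarRing (OpProduct ι) :=
  inferInstanceAs (StarRing (lp (fun x : X => L2 (ι x) →L[ℂ] L2 (ι x)) ∞))

instance : CStarRing (OpProduct ι) :=
  inferInstanceAs (CStarRing (lp (fun x : X => L2 (ι x) →L[ℂ] L2 (ι x)) ∞))

noncomputable instance : NormedSpace ℂ (OpProduct ι) :=
  inferInstanceAs (NormedSpace ℂ (lp (fun x : X => L2 (ι x) →L[ℂ] L2 (ι x)) ∞))

instance : StarModule ℂ (OpProduct ι) :=
  inferInstanceAs (StarModule ℂ (lp (fun x : X => L2 (ι x) →L[ℂ] L2 (ι x)) ∞))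

instance : IsScalarTower ℂ (OpProduct ι) (OpProduct ι) :=
  inferInstanceAs (IsScalarTower ℂ (lp (fun x : X => L2 (ι x) →L[ℂ] L2 (ι x)) ∞)
    (lp (fun x : X => L2 (ι x) →L[ℂ] L2 (ι x)) ∞))

instance : SMulCommClass ℂ (OpProduct ι) (OpProduct ι) :=
  inferInstanceAs (SMulCommClass ℂ (lp (fun x : X => L2 (ι x) →L[ℂ] L2 (ι x)) ∞)
    (lp (fun x : X => L2 (ι x) →L[ℂ] L2 (ι x)) ∞))

instance : CompleteSpace (OpProduct ι) :=
  inferInstanceAs (CompleteSpace (lp (fun x : X => L2 (ι x) →L[ℂ] L2 (ι x)) ∞))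

variable {ι}

/-- The projection of the product onto its `x`-th factor. -/
noncomputable def eval (x : X) : OpProduct ι →⋆ₙₐ[ℂ] (L2 (ι x) →L[ℂ] L2 (ι x)) where
  toFun a := (show lp (fun x : X => L2 (ι x) →L[ℂ] L2 (ι x)) ∞ from a) x
  map_smul' _ _ := rfl
  map_zero' := rfl
  map_add' _ _ := rfl
  map_mul' _ _ := rfl
  map_star' _ := rfl

end OpProduct

variable (G : Type*) {X : Type*} [TopologicalSpace G] [TopologicalSpace X] [EtaleGroupoid G X]

variable {G} in
/-- The family `(ρ_x(f))_x`. Its norm is `sup_x ‖ρ_x(f)‖`, the reduced norm of `f`. -/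
noncomputable def regularFamily (f : Cc G) : OpProduct (SrcFiber G : X → Type _) :=
  (⟨fun x => rho x f, memℓp_rho f⟩ :
    lp (fun x : X => L2 (SrcFiber G x) →L[ℂ] L2 (SrcFiber G x)) ∞)

/-- The reduced C*-algebra `C*_r(G)`: the completion of (the image under `f ↦ (ρ_x(f))_x` of)
`C_c(G)` with respect to the norm `sup_x ‖ρ_x(f)‖`, realized as the closure of this image in the
product of the algebras `B(ℓ²(G_x))`. The image is already a `*`-subalgebra, since `C_c(G)` is closed
under convolution and involution, so `adjoin` adds no elements. -/
noncomputable def reducedGroupoidAlgebra :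
    NonUnitalStarSubalgebra ℂ (OpProduct (SrcFiber G : X → Type _)) :=
  (NonUnitalStarAlgebra.adjoin ℂ (Set.range (regularFamily (G := G)))).topologicalClosure

/-- The class of `f ∈ C_c(G)` in `C*_r(G)`. -/
noncomputable def toReduced (f : Cc G) : reducedGroupoidAlgebra G :=
  ⟨regularFamily f, NonUnitalStarSubalgebra.le_topologicalClosure _
    (NonUnitalStarAlgebra.subset_adjoin _ _ ⟨f, rfl⟩)⟩

/-- The extension of the representation `ρ_x` from `C_c(G)` to `C*_r(G)`. -/
noncomputable def rhoReduced (x : X) :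
    reducedGroupoidAlgebra G →⋆ₙₐ[ℂ] (L2 (SrcFiber G x) →L[ℂ] L2 (SrcFiber G x)) :=
  (OpProduct.eval x).comp (NonUnitalStarSubalgebraClass.subtype (reducedGroupoidAlgebra G))

theorem rhoReduced_toReduced (x : X) (f : Cc G) : rhoReduced G x (toReduced G f) = rho x f := rfl

theorem norm_toReduced (f : Cc G) : ‖toReduced G f‖ = ⨆ x : X, ‖rho x f‖ :=
  lp.norm_eq_ciSup (⟨fun x => rho x f, memℓp_rho f⟩ :
    lp (fun x : X => L2 (SrcFiber G x) →L[ℂ] L2 (SrcFiber G x)) ∞)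

end Reduced

/-! ### The left inverse hull, constructible ideals and semi-characters -/

section Hull

open Classical in
/-- The identity map `p_X` of a subset `X`, as a partial bijection. -/
noncomputable def idOn {T : Type*} (X : Set T) : T ≃. T := PEquiv.ofSet X

theorem idOn_eq_some_iff {T : Type*} {X : Set T} {s t : T} : idOn X s = some t ↔ t = s ∧ t ∈ X :=
  PEquiv.ofSet_eq_some_iff

variable {S : Type*} [LeftCancelMonoid S]

open Classical in
/-- The left translation `t ↦ st`, as a partial bijection of `S` with domain `S` and image `sS`. -/
noncomputable def leftTranslation (s : S) : S ≃. S where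
  toFun t := some (s * t)
  invFun r := if h : ∃ t, s * t = r then some h.choose else none
  inv t r := by
    constructor
    · intro h
      split_ifs at h with h'
      have : h'.choose = t := by simpa using h
      rw [← this]
      exact congrArg some h'.choose_spec
    · intro h
      have h1 : s * t = r := by simpa using h
      have h2 : ∃ t, s * t = r := ⟨t, h1⟩
      rw [dif_pos h2]
      have : h2.choose = t := mul_left_cancel (h2.choose_spec.trans h1.symm)
      simp [this]

/-- Membership in the left inverse hull: the partial bijections of `S` obtained from the left
translations by composition and inversion. -/
inductive InLeftHull : (S ≃. S) → Prop
  | translation (s : S) : InLeftHull (leftTranslation s)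
  | trans {g h : S ≃. S} : InLeftHull g → InLeftHull h → InLeftHull (g.trans h)
  | symm {g : S ≃. S} : InLeftHull g → InLeftHull g.symm

variable (S) in
/-- The left inverse hull `I_ℓ(S)`. For `g` in it, `g.1 s = some t` means that `s` is in the domain
of `g` and `g` maps `s` to `t`. -/
def LeftHull : Type _ := {g : S ≃. S // InLeftHull g}

theorem inLeftHull_refl : InLeftHull (PEquiv.refl S) := by
  have : leftTranslation (1 : S) = PEquiv.refl S := PEquiv.ext fun t => by
    change some (1 * t) = some t
    rw [one_mul]
  rw [← this]
  exact InLeftHull.translation 1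

namespace LeftHull

/-- The left translation by `s` as an element of `I_ℓ(S)`. -/
noncomputable def ofElem (s : S) : LeftHull S := ⟨leftTranslation s, InLeftHull.translation s⟩

/-- The identity map `p_S`. -/
def one : LeftHull S := ⟨PEquiv.refl S, inLeftHull_refl⟩

/-- The product `gh` in `I_ℓ(S)`: first apply `h`, then `g`. -/
def comp (g h : LeftHull S) : LeftHull S := ⟨h.1.trans g.1, h.2.trans g.2⟩

/-- The inverse in `I_ℓ(S)`. -/
def inv (g : LeftHull S) : LeftHull S := ⟨g.1.symm, g.2.symm⟩

end LeftHull

/-- A subset `X` of `S` is a constructible ideal if the identity map `p_X` of `X` belongs to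
`I_ℓ(S)`, that is, if `X` is the domain of an idempotent of `I_ℓ(S)`. -/
def IsConstructible (X : Set S) : Prop := InLeftHull (idOn X)

variable (S) in
/-- The collection `J(S)` of constructible ideals, which is identified with the semigroup `E(S)` of
idempotents of `I_ℓ(S)` by `X ↦ p_X`; the product of `E(S)` becomes the intersection. -/
def Constructible : Type _ := {X : Set S // IsConstructible X}

/-- The preimage of a set under a partial bijection. -/
def preimageSet (g : S ≃. S) (X : Set S) : Set S := {s | ∃ t, g s = some t ∧ t ∈ X}

theorem isConstructible_preimage {g : S ≃. S} (hg : InLeftHull g) {X : Set S}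
    (hX : IsConstructible X) : IsConstructible (preimageSet g X) := by
  have : idOn (preimageSet g X) = (g.trans (idOn X)).trans g.symm := by
    refine PEquiv.ext fun a => Option.ext fun b => ?_
    simp only [PEquiv.trans_eq_some, idOn_eq_some_iff, PEquiv.eq_some_iff]
    constructor
    · rintro ⟨rfl, t, ht, htX⟩
      exact ⟨t, ⟨t, ht, rfl, htX⟩, ht⟩
    · rintro ⟨t, ⟨u, hu, rfl, htX⟩, hb⟩
      exact ⟨g.inj hb hu, t, hb, htX⟩
  unfold IsConstructible
  rw [this]
  exact (hg.trans hX).trans hg.symm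

theorem isConstructible_univ : IsConstructible (Set.univ : Set S) := by
  have : idOn (Set.univ : Set S) = PEquiv.refl S :=
    PEquiv.ext fun a => Option.ext fun b => by
      rw [idOn_eq_some_iff, PEquiv.refl_apply, Option.some.injEq]
      simp [eq_comm]
  unfold IsConstructible
  rw [this]
  exact inLeftHull_refl

theorem isConstructible_inter {X Y : Set S} (hX : IsConstructible X) (hY : IsConstructible Y) :
    IsConstructible (X ∩ Y) := by
  have h : preimageSet (idOn X) Y = X ∩ Y := by
    ext s
    constructor
    · rintro ⟨t, h1, h2⟩
      obtain ⟨rfl, h3⟩ := idOn_eq_some_iff.1 h1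
      exact ⟨h3, h2⟩
    · rintro ⟨h1, h2⟩
      exact ⟨s, idOn_eq_some_iff.2 ⟨rfl, h1⟩, h2⟩
  rw [← h]
  exact isConstructible_preimage hX hY

namespace Constructible

/-- The intersection of two constructible ideals; `p_{X ∩ Y} = p_X p_Y`. -/
def inter (X Y : Constructible S) : Constructible S := ⟨X.1 ∩ Y.1, isConstructible_inter X.2 Y.2⟩

variable (S) in
/-- The ideal `S`. -/
def top : Constructible S := ⟨Set.univ, isConstructible_univ⟩

/-- The preimage `g⁻¹(X)`; it satisfies `p_{g⁻¹(X)} = g⁻¹ p_X g`. -/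
def preimage (g : LeftHull S) (X : Constructible S) : Constructible S :=
  ⟨preimageSet g.1 X.1, isConstructible_preimage g.2 X.2⟩

/-- The domain of `g ∈ I_ℓ(S)`; it satisfies `p_{dom g} = g⁻¹g`. -/
def dom (g : LeftHull S) : Constructible S := preimage g (top S)

theorem mem_preimage {g : LeftHull S} {X : Constructible S} {s : S} :
    s ∈ (preimage g X).1 ↔ ∃ t, g.1 s = some t ∧ t ∈ X.1 := Iff.rfl

theorem mem_dom {g : LeftHull S} {s : S} : s ∈ (dom g).1 ↔ ∃ t, g.1 s = some t := by
  exact ⟨fun ⟨t, h, _⟩ => ⟨t, h⟩, fun ⟨t, h⟩ => ⟨t, h, trivial⟩⟩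

theorem inter_comm (X Y : Constructible S) : inter X Y = inter Y X :=
  Subtype.ext (Set.inter_comm _ _)

end Constructible

open Constructible

variable (S) in
/-- The space of semi-characters of `E(S) ≅ J(S)`: multiplicative maps to `{0, 1}` that are not
identically zero, with the topology of pointwise convergence. -/
def Semicharacter : Type _ :=
  {χ : Constructible S → Bool // (∃ X, χ X = true) ∧ ∀ X Y, χ (inter X Y) = (χ X && χ Y)}

instance : TopologicalSpace (Semicharacter S) :=
  inferInstanceAs (TopologicalSpace {χ : Constructible S → Bool //
    (∃ X, χ X = true) ∧ ∀ X Y, χ (inter X Y) = (χ X && χ Y)})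

open Classical in
/-- The semi-character `χ_s`, `χ_s(p_X) = 1_X(s)`. -/
noncomputable def charAt (s : S) : Semicharacter S :=
  ⟨fun X => decide (s ∈ X.1), ⟨top S, by simp [top]⟩, fun X Y => by simp [inter]⟩

variable (S) in
/-- The space `Ω(S)`, the closure of `{χ_s | s ∈ S}` in the space of semi-characters. -/
def Omega : Type _ := {χ : Semicharacter S // χ ∈ closure (Set.range (charAt (S := S)))}

noncomputable instance : TopologicalSpace (Omega S) :=
  inferInstanceAs (TopologicalSpace {χ : Semicharacter S //
    χ ∈ closure (Set.range (charAt (S := S)))})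

/-- The point `χ_s` of `Ω(S)`. -/
noncomputable def Omega.point (s : S) : Omega S := ⟨charAt s, subset_closure ⟨s, rfl⟩⟩

/-- The value `χ(p_X)`. -/
def Omega.val (χ : Omega S) (X : Constructible S) : Bool := χ.1.1 X

/-! ### The extension of semi-characters and C*-regularity -/

/-- The set `X \ (X_1 ∪ ⋯ ∪ X_m)` for `F = {X_1, …, X_m}`. -/
def diffSet (X : Constructible S) (F : Finset (Constructible S)) : Set S :=
  X.1 \ ⋃ Y ∈ F, Y.1

variable (S) in
/-- The collection `J̄(S)` of sets `X \ (X_1 ∪ ⋯ ∪ X_m)` with `X, X_1, …, X_m ∈ J(S)` (including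
`m = 0`). -/
def barConstructible : Set (Set S) := {A | ∃ X F, A = diffSet X F}

/-- The relation `χ(p_A) = 1` for the extension of `χ ∈ Ω(S)` to `J̄(S)`: for
`A = X \ (X_1 ∪ ⋯ ∪ X_m)` it means that `χ(p_X) = 1` and `χ(p_{X_i}) = 0` for all `i`. -/
def Omega.BarOne (χ : Omega S) (A : Set S) : Prop :=
  ∃ X F, A = diffSet X F ∧ χ.val X = true ∧ ∀ Y ∈ F, χ.val Y = false

variable (S) in
/-- C*-regularity of `S`: whenever a nonempty set `A ∈ J̄(S)` is covered by the sets of fixed points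
of finitely many `h_k ∈ I_ℓ(S)`, it is covered by finitely many sets `Y_j ∈ J̄(S)` such that each
`Y_j` consists of fixed points of a single `h_{k_j}`. -/
def IsCStarRegular : Prop :=
  ∀ (n : ℕ) (h : Fin n → LeftHull S) (A : Set S), A ∈ barConstructible S → A.Nonempty →
    (A ⊆ ⋃ k, {s | (h k).1 s = some s}) →
    ∃ (l : ℕ) (Y : Fin l → Set S) (k : Fin l → Fin n),
      (∀ j, Y j ∈ barConstructible S) ∧ (A ⊆ ⋃ j, Y j) ∧
        ∀ j, ∀ s ∈ Y j, (h (k j)).1 s = some s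

/-! ### The groupoid `𝒢(S)` -/

/-- The pairs `(g, χ)` with `g ∈ I_ℓ(S)`, `χ ∈ Ω(S)` and `χ(g⁻¹g) = 1`. -/
@[ext] structure GermPair (S : Type*) [LeftCancelMonoid S] where
  elt : LeftHull S
  chi : Omega S
  mem : chi.val (dom elt) = true

/-- The relation `(g, χ) ∼ (h, χ)` iff `g|_A = h|_A` for some `A ∈ J̄(S)` with `χ(p_A) = 1`. It is
implied by the relation `gp_X = hp_X` for some `X ∈ J(S)` with `χ(p_X) = 1`, which defines the
reduction of the Paterson groupoid to `Ω(S)`. -/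
def GermPair.Rel (p q : GermPair S) : Prop :=
  p.chi = q.chi ∧ ∃ A, p.chi.BarOne A ∧ ∀ s ∈ A, p.elt.1 s = q.elt.1 s

theorem Omega.ext {χ ψ : Omega S} (h : ∀ X, χ.val X = ψ.val X) : χ = ψ :=
  Subtype.ext (Subtype.ext (funext h))

theorem Omega.continuous_val (X : Constructible S) : Continuous fun χ : Omega S => χ.val X :=
  (continuous_apply X).comp (continuous_subtype_val.comp continuous_subtype_val)

theorem Omega.val_inter (χ : Omega S) (X Y : Constructible S) :
    χ.val (inter X Y) = (χ.val X && χ.val Y) := χ.1.2.2 X Y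

theorem Omega.val_top (χ : Omega S) : χ.val (top S) = true := by
  obtain ⟨X, hX⟩ := χ.1.2.1
  have h1 : inter X (top S) = X := Subtype.ext (Set.inter_univ _)
  have h2 := χ.val_inter X (top S)
  rw [h1] at h2
  have hX' : χ.val X = true := hX
  rw [hX'] at h2
  simpa using h2.symm

theorem Omega.val_point (s : S) (X : Constructible S) :
    (Omega.point s).val X = true ↔ s ∈ X.1 := by
  simp [Omega.point, Omega.val, charAt]

/-- The filter on `S` of the sets containing all `s` with `χ_s` close to `χ`. -/
noncomputable def Omega.near (χ : Omega S) : Filter S := Filter.comap charAt (𝓝 χ.1)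

instance (χ : Omega S) : χ.near.NeBot := by
  rw [Omega.near, Filter.comap_neBot_iff_frequently]
  exact mem_closure_iff_frequently.1 χ.2

theorem Omega.near_iff (χ : Omega S) (X : Constructible S) :
    ∀ᶠ s in χ.near, (s ∈ X.1 ↔ χ.val X = true) := by
  have h1 : Continuous fun η : Semicharacter S => η.1 X :=
    (continuous_apply X).comp continuous_subtype_val
  have h2 : ∀ᶠ η : Semicharacter S in 𝓝 χ.1, η.1 X = χ.1.1 X :=
    h1.continuousAt.eventually_mem (IsOpen.mem_nhds (isOpen_discrete {χ.1.1 X}) rfl)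
  filter_upwards [Filter.preimage_mem_comap h2] with s hs
  have : (charAt s).1 X = χ.val X := hs
  rw [← this]
  simp [charAt]

theorem Omega.tendsto_of_forall {l : Filter S} {m : S → S} {η : Semicharacter S}
    (h : ∀ X, ∀ᶠ s in l, (m s ∈ X.1 ↔ η.1 X = true)) :
    Filter.Tendsto (fun s => charAt (m s)) l (𝓝 η) := by
  refine tendsto_subtype_rng.2 (tendsto_pi_nhds.2 fun X => ?_)
  refine tendsto_nhds_of_eventually_eq ?_
  filter_upwards [h X] with s hs
  have : (charAt (m s)).1 X = true ↔ η.1 X = true := by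
    rw [← hs]
    simp [charAt]
  exact Bool.eq_iff_iff.2 this

theorem Omega.barOne_mem_near {χ : Omega S} {A : Set S} (h : χ.BarOne A) :
    ∀ᶠ s in χ.near, s ∈ A := by
  obtain ⟨X, F, rfl, hX, hF⟩ := h
  have h2 : ∀ᶠ s in χ.near, ∀ Y ∈ F, s ∉ Y.1 := by
    rw [Filter.eventually_all_finset]
    intro Y hY
    filter_upwards [χ.near_iff Y] with s hs hsY
    have := hs.1 hsY
    rw [hF Y hY] at this
    exact absurd this (by simp)
  filter_upwards [χ.near_iff X, h2] with s hs1 hs2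
  refine ⟨hs1.2 hX, ?_⟩
  simpa using hs2

theorem Omega.exists_barOne {χ : Omega S} {p : S → Prop} (h : ∀ᶠ s in χ.near, p s) :
    ∃ A, χ.BarOne A ∧ ∀ s ∈ A, p s := by
  classical
  obtain ⟨W, hW, hWp⟩ := Filter.mem_comap.1 h
  obtain ⟨V, hVW, hVo, hχV⟩ := mem_nhds_iff.1 hW
  obtain ⟨V', hV'o, rfl⟩ := isOpen_induced_iff.1 hVo
  obtain ⟨I, u, hu, hIu⟩ := isOpen_pi_iff.1 hV'o χ.1.1 hχV
  have key : ∀ I : Finset (Constructible S), ∃ X, χ.val X = true ∧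
      ∀ Y ∈ I, χ.val Y = true → X.1 ⊆ Y.1 := by
    intro I
    induction I using Finset.induction_on with
    | empty => exact ⟨top S, χ.val_top, by simp⟩
    | insert Y I _ ih =>
      obtain ⟨X, hX, hXI⟩ := ih
      by_cases hY : χ.val Y = true
      · refine ⟨inter X Y, by rw [χ.val_inter, hX, hY]; rfl, fun Z hZ hZ1 => ?_⟩
        rcases Finset.mem_insert.1 hZ with rfl | hZ
        · exact Set.inter_subset_right
        · exact Set.inter_subset_left.trans (hXI Z hZ hZ1)
      · refine ⟨X, hX, fun Z hZ hZ1 => ?_⟩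
        rcases Finset.mem_insert.1 hZ with rfl | hZ
        · exact absurd hZ1 hY
        · exact hXI Z hZ hZ1
  obtain ⟨X, hX, hXI⟩ := key I
  refine ⟨_, ⟨X, I.filter fun Y => χ.val Y = false, rfl, hX, fun Y hY => (Finset.mem_filter.1 hY).2⟩,
    fun s hs => hWp (hVW ?_)⟩
  refine hIu fun Y hY => ?_
  have : (charAt s).1 Y = χ.1.1 Y := by
    cases hYv : χ.val Y with
    | true =>
      have h1 : s ∈ Y.1 := hXI Y hY hYv hs.1
      have h2 : χ.1.1 Y = true := hYv
      rw [h2]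
      simp [charAt, h1]
    | false =>
      have h1 : s ∉ Y.1 := fun h => hs.2 (by
        simp only [Set.mem_iUnion]
        exact ⟨Y, Finset.mem_filter.2 ⟨hY, hYv⟩, h⟩)
      have h2 : χ.1.1 Y = false := hYv
      rw [h2]
      simp [charAt, h1]
  rw [this]
  exact (hu Y hY).2

theorem GermPair.rel_iff {p q : GermPair S} :
    p.Rel q ↔ p.chi = q.chi ∧ ∀ᶠ s in p.chi.near, p.elt.1 s = q.elt.1 s := by
  refine and_congr_right fun _ => ⟨?_, fun h => Omega.exists_barOne h⟩
  rintro ⟨A, hA, h⟩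
  filter_upwards [Omega.barOne_mem_near hA] with s hs using h s hs

instance germSetoid : Setoid (GermPair S) where
  r := GermPair.Rel
  iseqv := by
    refine ⟨fun p => ?_, fun {p q} h => ?_, fun {p q r} h1 h2 => ?_⟩
    · exact GermPair.rel_iff.2 ⟨rfl, Filter.Eventually.of_forall fun _ => rfl⟩
    · rw [GermPair.rel_iff] at h ⊢
      refine ⟨h.1.symm, ?_⟩
      rw [← h.1]
      filter_upwards [h.2] with s hs using hs.symm
    · rw [GermPair.rel_iff] at h1 h2 ⊢
      refine ⟨h1.1.trans h2.1, ?_⟩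
      have h3 := h2.2
      rw [← h1.1] at h3
      filter_upwards [h1.2, h3] with s hs hs' using hs.trans hs'

/-- If `χ(dom g) = 1`, then `g s` is defined for `χ_s` close to `χ`. -/
theorem Omega.near_dom {χ : Omega S} {g : LeftHull S} (h : χ.val (dom g) = true) :
    ∀ᶠ s in χ.near, ∃ t, g.1 s = some t := by
  filter_upwards [χ.near_iff (dom g)] with s hs
  exact mem_dom.1 (hs.2 h)

/-- The semi-character `χ(g⁻¹ · g)`, that is, `p_X ↦ χ(g⁻¹ p_X g) = χ(p_{g⁻¹(X)})`. -/
def actSemi (g : LeftHull S) (χ : Omega S) (h : χ.val (dom g) = true) : Semicharacter S :=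
  ⟨fun X => χ.val (preimage g X), ⟨top S, h⟩, fun X Y => by
    rw [← χ.val_inter]
    refine congrArg χ.val (Subtype.ext (Set.ext fun s => ?_))
    simp only [inter, preimage, preimageSet, Set.mem_inter_iff, Set.mem_ofPred_eq]
    constructor
    · rintro ⟨t, h1, h2, h3⟩
      exact ⟨⟨t, h1, h2⟩, t, h1, h3⟩
    · rintro ⟨⟨t, h1, h2⟩, u, h3, h4⟩
      rw [h1] at h3
      obtain rfl := Option.some.inj h3
      exact ⟨t, h1, h2, h4⟩⟩

theorem tendsto_actSemi (g : LeftHull S) (χ : Omega S) (h : χ.val (dom g) = true) :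
    Filter.Tendsto (fun s => charAt ((g.1 s).getD 1)) χ.near (𝓝 (actSemi g χ h)) := by
  refine Omega.tendsto_of_forall fun X => ?_
  filter_upwards [χ.near_iff (preimage g X), Omega.near_dom h] with s h1 ⟨t, h2⟩
  change _ ↔ χ.val (preimage g X) = true
  rw [← h1, mem_preimage, h2]
  simp

/-- The action `χ ↦ χ(g⁻¹ · g)` of `g ∈ I_ℓ(S)` on the set of `χ ∈ Ω(S)` with `χ(g⁻¹g) = 1`. -/
def act (g : LeftHull S) (χ : Omega S) (h : χ.val (dom g) = true) : Omega S :=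
  ⟨actSemi g χ h, mem_closure_of_tendsto (tendsto_actSemi g χ h)
    (Filter.Eventually.of_forall fun _ => ⟨_, rfl⟩)⟩

theorem act_val (g : LeftHull S) (χ : Omega S) (h : χ.val (dom g) = true) (X : Constructible S) :
    (act g χ h).val X = χ.val (preimage g X) := rfl

theorem near_act {g : LeftHull S} {χ : Omega S} (h : χ.val (dom g) = true) {p : S → Prop}
    (hp : ∀ᶠ t in (act g χ h).near, p t) : ∀ᶠ s in χ.near, ∃ t, g.1 s = some t ∧ p t := by
  have h1 : Filter.Tendsto (fun s => (g.1 s).getD 1) χ.near (act g χ h).near :=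
    Filter.tendsto_comap_iff.2 (tendsto_actSemi g χ h)
  filter_upwards [h1.eventually hp, Omega.near_dom h] with s h2 ⟨t, h3⟩
  rw [h3] at h2
  exact ⟨t, h3, h2⟩

/-- Two points of `Ω(S)` agree at `X`, `Y` if `X` and `Y` contain the same points near `χ`. -/
theorem Omega.val_congr {χ : Omega S} {X Y : Constructible S}
    (h : ∀ᶠ s in χ.near, (s ∈ X.1 ↔ s ∈ Y.1)) : χ.val X = χ.val Y := by
  obtain ⟨s, h1, h2, h3⟩ := (h.and ((χ.near_iff X).and (χ.near_iff Y))).exists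
  exact Bool.eq_iff_iff.2 (by rw [← h2, ← h3, h1])

theorem act_congr {g h : LeftHull S} {χ : Omega S} (hg : χ.val (dom g) = true)
    (hh : χ.val (dom h) = true) (e : ∀ᶠ s in χ.near, g.1 s = h.1 s) :
    act g χ hg = act h χ hh := by
  refine Omega.ext fun X => ?_
  rw [act_val, act_val]
  refine Omega.val_congr ?_
  filter_upwards [e] with s hs
  rw [mem_preimage, mem_preimage, hs]

theorem act_inv_mem {g : LeftHull S} {χ : Omega S} (h : χ.val (dom g) = true) :
    (act g χ h).val (dom g.inv) = true := by
  rw [act_val, ← h]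
  refine Omega.val_congr (Filter.Eventually.of_forall fun s => ?_)
  rw [mem_preimage, mem_dom]
  constructor
  · rintro ⟨t, h1, -⟩
    exact ⟨t, h1⟩
  · rintro ⟨t, h1⟩
    exact ⟨t, h1, mem_dom.2 ⟨s, (PEquiv.eq_some_iff g.1).2 h1⟩⟩

theorem act_inv_act {g : LeftHull S} {χ : Omega S} (h : χ.val (dom g) = true) :
    act g.inv (act g χ h) (act_inv_mem h) = χ := by
  refine Omega.ext fun X => ?_
  rw [act_val, act_val]
  refine Omega.val_congr ?_
  filter_upwards [Omega.near_dom h] with s ⟨t, ht⟩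
  constructor
  · rintro ⟨t', h1, u, h2, h3⟩
    have h4 : g.1 u = some t' := (PEquiv.eq_some_iff g.1).1 h2
    rwa [g.1.inj h1 h4]
  · intro h1
    exact ⟨t, ht, s, (PEquiv.eq_some_iff g.1).2 ht, h1⟩

theorem near_act_inv {g : LeftHull S} {χ : Omega S} (h : χ.val (dom g) = true) {p : S → Prop}
    (hp : ∀ᶠ s in χ.near, p s) :
    ∀ᶠ t in (act g χ h).near, ∃ s, g.1 s = some t ∧ p s := by
  have h1 : ∀ᶠ s in (act g.inv (act g χ h) (act_inv_mem h)).near, p s := by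
    rwa [act_inv_act h]
  filter_upwards [near_act _ h1] with t ⟨s, h2, h3⟩
  exact ⟨s, (PEquiv.eq_some_iff g.1).1 h2, h3⟩

theorem comp_apply_eq_some {g h : LeftHull S} {s t : S} :
    (g.comp h).1 s = some t ↔ ∃ u, h.1 s = some u ∧ g.1 u = some t :=
  PEquiv.trans_eq_some _ _ _ _

theorem comp_mem {g h : LeftHull S} {χ : Omega S} (hh : χ.val (dom h) = true)
    (hg : (act h χ hh).val (dom g) = true) : χ.val (dom (g.comp h)) = true := by
  rw [← hg, act_val]
  refine Omega.val_congr (Filter.Eventually.of_forall fun s => ?_)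
  simp only [mem_dom, mem_preimage, comp_apply_eq_some]
  constructor
  · rintro ⟨t, u, h1, h2⟩
    exact ⟨u, h1, t, h2⟩
  · rintro ⟨u, h1, t, h2⟩
    exact ⟨t, u, h1, h2⟩

theorem act_comp {g h : LeftHull S} {χ : Omega S} (hh : χ.val (dom h) = true)
    (hg : (act h χ hh).val (dom g) = true) :
    act (g.comp h) χ (comp_mem hh hg) = act g (act h χ hh) hg := by
  refine Omega.ext fun X => ?_
  simp only [act_val]
  refine Omega.val_congr (Filter.Eventually.of_forall fun s => ?_)
  simp only [mem_preimage, comp_apply_eq_some]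
  constructor
  · rintro ⟨t, ⟨u, h1, h2⟩, h3⟩
    exact ⟨u, h1, t, h2, h3⟩
  · rintro ⟨u, h1, t, h2, h3⟩
    exact ⟨t, ⟨u, h1, h2⟩, h3⟩

theorem one_mem (χ : Omega S) : χ.val (dom LeftHull.one) = true := by
  rw [← χ.val_top]
  refine Omega.val_congr (Filter.Eventually.of_forall fun s => ?_)
  rw [mem_dom]
  exact ⟨fun _ => trivial, fun _ => ⟨s, rfl⟩⟩

theorem act_one (χ : Omega S) : act LeftHull.one χ (one_mem χ) = χ := by
  refine Omega.ext fun X => ?_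
  rw [act_val]
  refine Omega.val_congr (Filter.Eventually.of_forall fun s => ?_)
  rw [mem_preimage]
  constructor
  · rintro ⟨t, h1, h2⟩
    obtain rfl : s = t := Option.some.inj h1
    exact h2
  · exact fun h => ⟨s, rfl, h⟩

/-- The range `χ(g⁻¹ · g)` of `(g, χ)`. -/
def GermPair.range (p : GermPair S) : Omega S := act p.elt p.chi p.mem

theorem GermPair.range_congr {p q : GermPair S} (h : p.Rel q) : p.range = q.range := by
  obtain ⟨g, χ, hg⟩ := p
  obtain ⟨g', χ', hg'⟩ := q
  obtain ⟨rfl, h2⟩ := GermPair.rel_iff.1 h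
  exact act_congr _ _ h2

/-- The inverse `(g⁻¹, χ(g⁻¹ · g))` of `(g, χ)`. -/
def GermPair.inv (p : GermPair S) : GermPair S := ⟨p.elt.inv, p.range, act_inv_mem p.mem⟩

open Classical in
/-- The product `(gh, ψ)` of `(g, χ)` and `(h, ψ)` if `χ = ψ(h⁻¹ · h)`; the value is immaterial
otherwise. -/
noncomputable def GermPair.mul (p q : GermPair S) : GermPair S :=
  if h : p.chi = q.range then ⟨p.elt.comp q.elt, q.chi, comp_mem q.mem (by
    have h1 := p.mem
    rw [h] at h1
    exact h1)⟩ else q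

theorem GermPair.mul_eq {p q : GermPair S} (h : p.chi = q.range) :
    p.mul q = ⟨p.elt.comp q.elt, q.chi, comp_mem q.mem (by
      have h1 := p.mem
      rw [h] at h1
      exact h1)⟩ := dif_pos h

variable (S) in
/-- The set of arrows of the groupoid `𝒢(S)`: the germs `[g, χ]`. -/
def GermGroupoid : Type _ := Quotient (germSetoid (S := S))

/-- The germ `[g, χ]`. -/
def germ (g : LeftHull S) (χ : Omega S) (h : χ.val (dom g) = true) : GermGroupoid S :=
  Quotient.mk _ ⟨g, χ, h⟩

/-- The set `D(g, U) = {[g, χ] | χ ∈ U}`. -/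
def germSet (g : LeftHull S) (U : Set (Omega S)) : Set (GermGroupoid S) :=
  {a | ∃ χ ∈ U, ∃ h : χ.val (dom g) = true, germ g χ h = a}

/-- The topology on `𝒢(S)` with the sets `D(g, U)`, `U` open, as a basis. -/
instance : TopologicalSpace (GermGroupoid S) :=
  TopologicalSpace.generateFrom {W | ∃ g U, IsOpen U ∧ W = germSet g U}

theorem germ_eq_iff {g h : LeftHull S} {χ ψ : Omega S} (hg : χ.val (dom g) = true)
    (hh : ψ.val (dom h) = true) :
    germ g χ hg = germ h ψ hh ↔ χ = ψ ∧ ∀ᶠ s in χ.near, g.1 s = h.1 s :=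
  Quotient.eq.trans (GermPair.rel_iff (p := ⟨g, χ, hg⟩) (q := ⟨h, ψ, hh⟩))

theorem GermPair.inv_congr {p q : GermPair S} (h : p.Rel q) : p.inv.Rel q.inv := by
  have hr := GermPair.range_congr h
  obtain ⟨g, χ, hg⟩ := p
  obtain ⟨g', χ', hg'⟩ := q
  obtain ⟨rfl, h2⟩ := GermPair.rel_iff.1 h
  refine GermPair.rel_iff.2 ⟨hr, ?_⟩
  filter_upwards [near_act_inv hg h2] with t ⟨s, h3, h4⟩
  change g.1.symm t = g'.1.symm t
  rw [(PEquiv.eq_some_iff g.1).2 h3]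
  exact ((PEquiv.eq_some_iff g'.1).2 (h4 ▸ h3)).symm

theorem GermPair.mul_congr {p p' q q' : GermPair S} (hp : p.Rel p') (hq : q.Rel q') :
    (p.mul q).Rel (p'.mul q') := by
  have hr := GermPair.range_congr hq
  obtain ⟨g, χ, hg⟩ := p
  obtain ⟨g', χ', hg'⟩ := p'
  obtain ⟨h, ψ, hh⟩ := q
  obtain ⟨h', ψ', hh'⟩ := q'
  obtain ⟨hχ, h2⟩ := GermPair.rel_iff.1 hp
  obtain ⟨hψ, h3⟩ := GermPair.rel_iff.1 hq
  simp only at hχ hψ h2 h3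
  subst hχ
  subst hψ
  by_cases hc : χ = (⟨h, ψ, hh⟩ : GermPair S).range
  · rw [GermPair.mul, dif_pos hc, GermPair.mul, dif_pos (hc.trans hr)]
    refine GermPair.rel_iff.2 ⟨rfl, ?_⟩
    simp only
    rw [hc] at h2
    filter_upwards [near_act hh h2, h3] with s ⟨t, h4, h5⟩ h6
    refine Option.ext fun r => ?_
    rw [comp_apply_eq_some, comp_apply_eq_some, ← h6, h4]
    simp [h5]
  · rw [GermPair.mul, dif_neg hc, GermPair.mul, dif_neg fun h => hc (h.trans hr.symm)]
    exact hq

/-- The groupoid structure of `𝒢(S)`, with unit space `Ω(S)`. -/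
noncomputable instance : ArrowGroupoid (GermGroupoid S) (Omega S) where
  src := Quotient.lift (fun p => p.chi) fun _ _ h => h.1
  rng := Quotient.lift (fun p => p.range) fun _ _ h => GermPair.range_congr h
  unit χ := germ LeftHull.one χ (one_mem χ)
  inv := Quotient.map GermPair.inv fun _ _ h => GermPair.inv_congr h
  mul := Quotient.map₂ GermPair.mul fun _ _ h _ _ h' => GermPair.mul_congr h h'
  src_unit χ := rfl
  rng_unit χ := act_one χ
  src_inv a := Quotient.inductionOn a fun _ => rfl
  rng_inv a := Quotient.inductionOn a fun p => act_inv_act p.mem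
  src_mul a b := Quotient.inductionOn₂ a b fun p q (h : p.chi = q.range) => by
    change (p.mul q).chi = q.chi
    rw [GermPair.mul_eq h]
  rng_mul a b := Quotient.inductionOn₂ a b fun p q (h : p.chi = q.range) => by
    change (p.mul q).range = p.range
    obtain ⟨g, χ, hg⟩ := p
    simp only at h
    subst h
    rw [GermPair.mul_eq rfl]
    exact act_comp q.mem hg
  assoc a b c := Quotient.inductionOn₃ a b c
    fun p q r (h : p.chi = q.range) (h' : q.chi = r.range) => by
      obtain ⟨g, χ, hg⟩ := p
      obtain ⟨g', χ', hg'⟩ := q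
      simp only at h h'
      subst h'
      subst h
      change (Quotient.mk _ _ : GermGroupoid S) = Quotient.mk _ _
      have e1 : (GermPair.mk g' r.range hg').mul r = ⟨g'.comp r.elt, r.chi, comp_mem r.mem hg'⟩ :=
        GermPair.mul_eq rfl
      have e2 : (GermPair.mk g (GermPair.mk g' r.range hg').range hg).mul ⟨g', r.range, hg'⟩
          = ⟨g.comp g', r.range, comp_mem hg' hg⟩ := GermPair.mul_eq rfl
      rw [e1, e2]
      refine congrArg _ ((GermPair.mul_eq rfl).trans (Eq.trans ?_
        (GermPair.mul_eq (act_comp r.mem hg').symm).symm))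
      exact GermPair.ext (Subtype.ext (PEquiv.trans_assoc _ _ _).symm) rfl
  unit_mul a := Quotient.inductionOn a fun p => by
    change (Quotient.mk _ (GermPair.mul ⟨LeftHull.one, p.range, one_mem _⟩ p) : GermGroupoid S)
      = Quotient.mk _ _
    rw [GermPair.mul_eq rfl]
    exact congrArg _ (GermPair.ext (Subtype.ext (PEquiv.trans_refl _)) rfl)
  mul_unit a := Quotient.inductionOn a fun p => by
    change (Quotient.mk _ (GermPair.mul p ⟨LeftHull.one, p.chi, one_mem _⟩) : GermGroupoid S)
      = Quotient.mk _ _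
    rw [GermPair.mul_eq (act_one p.chi).symm]
    exact congrArg _ (GermPair.ext (Subtype.ext (PEquiv.refl_trans _)) rfl)
  inverse_mul a := Quotient.inductionOn a fun p => by
    change (Quotient.mk _ (p.inv.mul p) : GermGroupoid S) = germ LeftHull.one p.chi (one_mem _)
    rw [GermPair.mul_eq (p := p.inv) rfl]
    refine (germ_eq_iff _ _).2 ⟨rfl, ?_⟩
    filter_upwards [Omega.near_dom p.mem] with s ⟨t, ht⟩
    change _ = some s
    exact comp_apply_eq_some.2 ⟨t, ht, (PEquiv.eq_some_iff p.elt.1).2 ht⟩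
  mul_inverse a := Quotient.inductionOn a fun p => by
    change (Quotient.mk _ (p.mul p.inv) : GermGroupoid S) = germ LeftHull.one p.range (one_mem _)
    rw [GermPair.mul_eq (q := p.inv) (act_inv_act p.mem).symm]
    refine (germ_eq_iff _ _).2 ⟨rfl, ?_⟩
    filter_upwards [near_act_inv p.mem (Filter.Eventually.of_forall fun _ => trivial)]
      with t ⟨s, hs, _⟩
    change _ = some t
    exact comp_apply_eq_some.2 ⟨s, (PEquiv.eq_some_iff p.elt.1).2 hs, hs⟩

end Hull

/-! ### The étale topology of `𝒢(S)` -/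

section Topology

variable {S : Type*} [LeftCancelMonoid S]

open Constructible ArrowGroupoid

theorem src_germ (g : LeftHull S) (χ : Omega S) (h : χ.val (dom g) = true) :
    src (germ g χ h) = χ := rfl

theorem rng_germ (g : LeftHull S) (χ : Omega S) (h : χ.val (dom g) = true) :
    rng (germ g χ h) = act g χ h := rfl

theorem inv_germ (g : LeftHull S) (χ : Omega S) (h : χ.val (dom g) = true) :
    inv (germ g χ h) = germ g.inv (act g χ h) (act_inv_mem h) := rfl

theorem mul_germ (g h : LeftHull S) (χ : Omega S) (hh : χ.val (dom h) = true)
    (hg : (act h χ hh).val (dom g) = true) :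
    mul (germ g (act h χ hh) hg) (germ h χ hh) = germ (g.comp h) χ (comp_mem hh hg) :=
  congrArg (Quotient.mk _) (GermPair.mul_eq (p := ⟨g, act h χ hh, hg⟩) (q := ⟨h, χ, hh⟩) rfl)

theorem exists_germ (a : GermGroupoid S) : ∃ g χ h, germ (S := S) g χ h = a :=
  Quotient.inductionOn a fun p => ⟨p.elt, p.chi, p.mem, rfl⟩

/-- The clopen set of `χ ∈ Ω(S)` with `χ(g⁻¹g) = 1`. -/
abbrev DomSpace (g : LeftHull S) : Type _ := {χ : Omega S // χ.val (dom g) = true}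

/-- The section `χ ↦ [g, χ]`. -/
def sec (g : LeftHull S) (χ : DomSpace g) : GermGroupoid S := germ g χ.1 χ.2

theorem isOpen_dom (g : LeftHull S) : IsOpen {χ : Omega S | χ.val (dom g) = true} :=
  (isOpen_discrete {true}).preimage (Omega.continuous_val (dom g))

theorem isOpen_germSet (g : LeftHull S) {U : Set (Omega S)} (hU : IsOpen U) :
    IsOpen (germSet g U) := TopologicalSpace.isOpen_generateFrom_of_mem ⟨g, U, hU, rfl⟩

theorem isOpen_barOne (A : Set S) : IsOpen {χ : Omega S | χ.BarOne A} := by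
  have : {χ : Omega S | χ.BarOne A} = ⋃ (X : Constructible S) (F : Finset (Constructible S))
      (_ : A = diffSet X F), ({χ : Omega S | χ.val X = true} ∩
        ⋂ Y ∈ F, {χ : Omega S | χ.val Y = false}) := by
    ext χ
    simp only [Omega.BarOne, Set.mem_ofPred_eq, Set.mem_iUnion, Set.mem_inter_iff, Set.mem_iInter,
      exists_prop]
  rw [this]
  refine isOpen_iUnion fun X => isOpen_iUnion fun F => isOpen_iUnion fun _ => ?_
  refine IsOpen.inter ((isOpen_discrete {true}).preimage (Omega.continuous_val X)) ?_
  exact isOpen_biInter_finset fun Y _ =>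
    (isOpen_discrete {false}).preimage (Omega.continuous_val Y)

theorem isOpen_near (p : S → Prop) : IsOpen {χ : Omega S | ∀ᶠ s in χ.near, p s} := by
  refine isOpen_iff_forall_mem_open.2 fun χ hχ => ?_
  obtain ⟨A, hA, hp⟩ := Omega.exists_barOne hχ
  exact ⟨_, fun η hη => (Omega.barOne_mem_near hη).mono hp, isOpen_barOne A, hA⟩

theorem continuous_sec (g : LeftHull S) : Continuous (sec g) := by
  refine continuous_generateFrom_iff.2 ?_
  rintro _ ⟨h, U, hU, rfl⟩
  have : sec g ⁻¹' germSet h U = Subtype.val ⁻¹' (U ∩ {χ : Omega S | χ.val (dom h) = true} ∩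
      {χ : Omega S | ∀ᶠ s in χ.near, h.1 s = g.1 s}) := by
    ext χ
    constructor
    · rintro ⟨ψ, hψU, hψ, e⟩
      obtain ⟨e1, e2⟩ := (germ_eq_iff hψ χ.2).1 e
      rw [e1] at hψU hψ e2
      exact ⟨⟨hψU, hψ⟩, e2⟩
    · rintro ⟨⟨h1, h2⟩, h3⟩
      exact ⟨χ.1, h1, h2, (germ_eq_iff h2 χ.2).2 ⟨rfl, h3⟩⟩
  rw [this]
  exact ((hU.inter (isOpen_dom h)).inter (isOpen_near _)).preimage continuous_subtype_val

theorem sec_image (g : LeftHull S) (V : Set (DomSpace g)) :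
    sec g '' V = germSet g (Subtype.val '' V) := by
  ext a
  constructor
  · rintro ⟨χ, hχ, rfl⟩
    exact ⟨χ.1, ⟨χ, hχ, rfl⟩, χ.2, rfl⟩
  · rintro ⟨_, ⟨χ, hχ, rfl⟩, h, rfl⟩
    exact ⟨χ, hχ, rfl⟩

theorem isOpenMap_sec (g : LeftHull S) : IsOpenMap (sec g) := fun V hV => by
  rw [sec_image]
  exact isOpen_germSet g ((isOpen_dom g).isOpenMap_subtype_val V hV)

theorem continuous_of_sec {Z : Type*} [TopologicalSpace Z] {f : GermGroupoid S → Z}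
    (h : ∀ g, Continuous fun χ => f (sec g χ)) : Continuous f := by
  refine continuous_def.2 fun W hW => ?_
  have : f ⁻¹' W = ⋃ g, sec g '' ((fun χ => f (sec g χ)) ⁻¹' W) := by
    ext a
    obtain ⟨g, χ, hχ, rfl⟩ := exists_germ a
    simp only [Set.mem_preimage, Set.mem_iUnion]
    constructor
    · intro h1
      exact ⟨g, ⟨χ, hχ⟩, h1, rfl⟩
    · rintro ⟨g', ψ, h1, h2⟩
      rw [← h2]
      exact h1
  rw [this]
  exact isOpen_iUnion fun g => isOpenMap_sec g _ (hW.preimage (h g))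

theorem continuous_src : Continuous (src : GermGroupoid S → Omega S) :=
  continuous_of_sec fun _ => continuous_subtype_val

theorem continuous_act (g : LeftHull S) : Continuous fun χ : DomSpace g => act g χ.1 χ.2 :=
  Continuous.subtype_mk (Continuous.subtype_mk (continuous_pi fun X =>
    (Omega.continuous_val (preimage g X)).comp continuous_subtype_val) _) _

theorem continuous_inv_germ : Continuous (inv : GermGroupoid S → GermGroupoid S) :=
  continuous_of_sec fun g => (continuous_sec g.inv).comp
    ((continuous_act g).subtype_mk fun χ => act_inv_mem χ.2)

theorem inv_inv_germ (a : GermGroupoid S) : inv (inv a) = a := by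
  obtain ⟨g, χ, h, rfl⟩ := exists_germ a
  rw [inv_germ, inv_germ]
  exact (germ_eq_iff _ _).2 ⟨act_inv_act h, Filter.Eventually.of_forall fun _ => rfl⟩

/-- The inversion of `𝒢(S)` as a homeomorphism. -/
noncomputable def invHomeomorph : GermGroupoid S ≃ₜ GermGroupoid S where
  toFun := inv
  invFun := inv
  left_inv := inv_inv_germ
  right_inv := inv_inv_germ
  continuous_toFun := continuous_inv_germ
  continuous_invFun := continuous_inv_germ

theorem isOpenMap_src : IsOpenMap (src : GermGroupoid S → Omega S) := fun W hW => by
  have : src '' W = ⋃ g : LeftHull S, Subtype.val '' (sec g ⁻¹' W) := by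
    ext χ
    simp only [Set.mem_iUnion]
    constructor
    · rintro ⟨a, ha, rfl⟩
      obtain ⟨g, χ, hχ, rfl⟩ := exists_germ a
      exact ⟨g, ⟨χ, hχ⟩, ha, rfl⟩
    · rintro ⟨g, ψ, h1, rfl⟩
      exact ⟨_, h1, rfl⟩
  rw [this]
  exact isOpen_iUnion fun g =>
    (isOpen_dom g).isOpenMap_subtype_val _ (hW.preimage (continuous_sec g))

theorem src_isLocalHomeomorph_germ : IsLocalHomeomorph (src : GermGroupoid S → Omega S) := by
  refine isLocalHomeomorph_iff_isOpenEmbedding_restrict.2 fun a => ?_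
  obtain ⟨g, χ, hχ, rfl⟩ := exists_germ a
  have hO : IsOpen (germSet g (Set.univ : Set (Omega S))) := isOpen_germSet g isOpen_univ
  refine ⟨germSet g Set.univ, hO.mem_nhds ⟨χ, trivial, hχ, rfl⟩, ?_⟩
  refine Topology.IsOpenEmbedding.of_continuous_injective_isOpenMap
    (continuous_src.comp continuous_subtype_val) ?_
    (isOpenMap_src.comp hO.isOpenMap_subtype_val)
  rintro ⟨_, χ, _, h, rfl⟩ ⟨_, ψ, _, h', rfl⟩ (e : χ = ψ)
  subst e
  rfl

theorem rng_isLocalHomeomorph_germ : IsLocalHomeomorph (rng : GermGroupoid S → Omega S) := by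
  have : (rng : GermGroupoid S → Omega S) = src ∘ invHomeomorph :=
    funext fun a => (src_inv a).symm
  rw [this]
  exact src_isLocalHomeomorph_germ.comp invHomeomorph.isLocalHomeomorph

theorem continuous_mul_germ : Continuous
    fun p : {p : GermGroupoid S × GermGroupoid S // src p.1 = rng p.2} => mul p.1.1 p.1.2 := by
  refine continuous_def.2 fun W hW => isOpen_iff_forall_mem_open.2 ?_
  rintro ⟨⟨a, b⟩, hab⟩ hW'
  obtain ⟨h, χ, hh, rfl⟩ := exists_germ b
  obtain ⟨g, ψ, hg, rfl⟩ := exists_germ a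
  obtain rfl : ψ = act h χ hh := hab
  have hV : IsOpen (Subtype.val '' (sec (g.comp h) ⁻¹' W)) :=
    (isOpen_dom (g.comp h)).isOpenMap_subtype_val _ (hW.preimage (continuous_sec _))
  refine ⟨(fun p => p.1.1) ⁻¹' germSet g Set.univ ∩
    (fun p => p.1.2) ⁻¹' germSet h (Subtype.val '' (sec (g.comp h) ⁻¹' W)), ?_, ?_, ?_⟩
  · rintro ⟨⟨_, _⟩, hab⟩ ⟨⟨ψ', -, hg', rfl⟩, ⟨_, ⟨η, hη, rfl⟩, hh', rfl⟩⟩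
    obtain rfl : ψ' = act h η.1 hh' := hab
    change mul (germ g _ _) (germ h _ _) ∈ W
    rw [mul_germ]
    exact hη
  · exact ((isOpen_germSet g isOpen_univ).preimage
      (continuous_fst.comp continuous_subtype_val)).inter
      ((isOpen_germSet h hV).preimage (continuous_snd.comp continuous_subtype_val))
  · change mul (germ g _ _) (germ h _ _) ∈ W at hW'
    rw [mul_germ] at hW'
    exact ⟨⟨_, trivial, hg, rfl⟩, ⟨χ, ⟨⟨χ, comp_mem hh hg⟩, hW', rfl⟩, hh, rfl⟩⟩

instance : T2Space (Semicharacter S) :=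
  inferInstanceAs (T2Space {χ : Constructible S → Bool //
    (∃ X, χ X = true) ∧ ∀ X Y, χ (inter X Y) = (χ X && χ Y)})

instance : T2Space (Omega S) :=
  inferInstanceAs (T2Space {χ : Semicharacter S // χ ∈ closure (Set.range (charAt (S := S)))})

instance : CompactSpace (Semicharacter S) := by
  have hcl : IsClosed {χ : Constructible S → Bool |
      (∃ X, χ X = true) ∧ ∀ X Y, χ (inter X Y) = (χ X && χ Y)} := by
    have : {χ : Constructible S → Bool |
        (∃ X, χ X = true) ∧ ∀ X Y, χ (inter X Y) = (χ X && χ Y)} =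
        {χ | χ (top S) = true} ∩ ⋂ (X) (Y), {χ | χ (inter X Y) = (χ X && χ Y)} := by
      ext χ
      simp only [Set.mem_ofPred_eq, Set.mem_inter_iff, Set.mem_iInter]
      constructor
      · rintro ⟨⟨X, hX⟩, h⟩
        refine ⟨?_, h⟩
        have h1 : inter X (top S) = X := Subtype.ext (Set.inter_univ _)
        have h2 := h X (top S)
        rw [h1, hX] at h2
        simpa using h2.symm
      · rintro ⟨h1, h2⟩
        exact ⟨⟨_, h1⟩, h2⟩
    rw [this]
    refine (isClosed_eq (continuous_apply _) continuous_const).inter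
      (isClosed_iInter fun X => isClosed_iInter fun Y => isClosed_eq (continuous_apply _) ?_)
    have h1 : Continuous fun p : Bool × Bool => (p.1 && p.2) := continuous_of_discreteTopology
    have h2 : Continuous fun χ : Constructible S → Bool => (χ X, χ Y) :=
      (continuous_apply X).prodMk (continuous_apply Y)
    exact h1.comp h2
  exact isCompact_iff_compactSpace.1 hcl.isCompact

instance : CompactSpace (Omega S) :=
  isCompact_iff_compactSpace.1 (isClosed_closure (s := Set.range (charAt (S := S)))).isCompact

/-- `𝒢(S)` is an étale groupoid with compact Hausdorff unit space `Ω(S)`. -/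
noncomputable instance : EtaleGroupoid (GermGroupoid S) (Omega S) where
  continuous_inv := continuous_inv_germ
  continuous_mul := continuous_mul_germ
  unit_isEmbedding := Function.LeftInverse.isEmbedding (f := src) (fun χ => src_unit χ)
    continuous_src ((continuous_sec LeftHull.one).comp (continuous_id.subtype_mk one_mem))
  t2_units := inferInstance
  locallyCompact_units := inferInstance
  src_isLocalHomeomorph := src_isLocalHomeomorph_germ
  rng_isLocalHomeomorph := rng_isLocalHomeomorph_germ

end Topology

/-! ### The reduced C*-algebra of `S` -/

section Semigroup

variable {S : Type*} [LeftCancelMonoid S]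

theorem orthonormal_delta_mul (s : S) : Orthonormal ℂ fun t : S => delta (s * t) := by
  classical
  rw [orthonormal_iff_ite]
  intro t u
  unfold delta
  rw [lp.inner_single_left]
  simp only [lp.single_apply, Pi.single_apply, mul_left_cancel_iff]
  split_ifs <;> simp_all

/-- The operator `λ_s` of the left regular representation on `ℓ²(S)`, `λ_s δ_t = δ_{st}`. -/
noncomputable def leftRegular (s : S) : L2 S →L[ℂ] L2 S :=
  (orthonormal_delta_mul s).orthogonalFamily.linearIsometry.toContinuousLinearMap

theorem leftRegular_delta (s t : S) : leftRegular s (delta t) = delta (s * t) := by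
  classical
  have h := (orthonormal_delta_mul s).orthogonalFamily.linearIsometry_apply_single (i := t) (1 : ℂ)
  rw [LinearIsometry.toSpanSingleton_apply, one_smul] at h
  rw [← h]
  unfold leftRegular delta
  congr!

variable (S) in
/-- The reduced C*-algebra `C*_r(S)`, generated by the operators `λ_s`, `s ∈ S`. -/
noncomputable def reducedSemigroupAlgebra : StarSubalgebra ℂ (L2 S →L[ℂ] L2 S) :=
  (StarAlgebra.adjoin ℂ (Set.range (leftRegular (S := S)))).topologicalClosure

open Constructible in
theorem point_mem_dom_ofElem (s t : S) :
    (Omega.point t).val (dom (LeftHull.ofElem s)) = true :=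
  (Omega.val_point t _).2 (mem_dom.2 ⟨s * t, rfl⟩)

/-- The arrow `[s, χ_e]` of `𝒢(S)`, an element of the fibre `𝒢(S)_{χ_e}`. -/
noncomputable def baseArrow (s : S) :
    SrcFiber (GermGroupoid S) (Omega.point (1 : S)) :=
  ⟨germ (LeftHull.ofElem s) (Omega.point 1) (point_mem_dom_ofElem s 1), rfl⟩

end Semigroup

end SemigroupCStar

/-! Let 1_{D(g)} be the indicator function of the compact open bisection D(g). On ℓ²(𝒢_χ) it sends
δ_{[h,χ]} to δ_{[gh,χ]}, or to 0 if [gh,χ] is undefined (`eval_indicatorElem_deltaOpt`). Hence g ↦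
1_{D(g)} is multiplicative and respects adjoints, so these elements span a *-algebra. Its closure
contains C*_r(𝒢(S)) (`reducedGroupoidAlgebra_le`): functions in C_c can be cut along compact open
bisections, and on each of them Stone–Weierstrass approximates by combinations of smaller
indicators.

The heart of the matter is the inequality ‖ρ_χ(a)‖ ≤ ‖ρ_{χ_e}(a)‖ for a = ∑ c_g 1_{D(g)} and every χ
∈ Ω(S) (`IsCStarRegular.norm_eval_le`). For a finitely supported vector ξ = ∑ z_k δ_{[h_k,χ]}, the
norms of ξ and ρ_χ(a)ξ depend only on which of the germs [h_k,χ] and [gh_k,χ] are defined and which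
of them coincide (`norm_sum_deltaOpt`). C*-regularity yields a point s ∈ S at which the finitely
many maps h_k and gh_k show exactly the same pattern of values (`IsCStarRegular.exists_generic`).
Otherwise a neighbourhood of χ would be covered by the fixed-point sets of finitely many g'⁻¹g with
[g,χ] ≠ [g',χ]; regularity would then make one of these the identity near χ, a contradiction.

Elements of I_ℓ(S) commute with right translations, so a germ at χ_e is determined by the value at e
(`germOpt_point_one_eq_iff`). Thus the pattern at s is that of the germs [h_k s,χ_e] and [gh_k
s,χ_e], and ξ can be replaced by a vector over χ_e. It follows that ρ_{χ_e} is isometric on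
C*_r(𝒢(S)). The same description of germs gives a bijection S → 𝒢_{χ_e}, hence U, which turns
1_{D(s)} into λ_s. The image is therefore closed and equal to C*_r(S). -/

namespace SemigroupCStar

/-! ### Basis vectors and operators on ℓ² -/

section Hilbert

variable {ι κ : Type*}

theorem delta_apply [DecidableEq ι] (i j : ι) : (delta i : L2 ι) j = if j = i then 1 else 0 := by
  unfold delta
  rw [@lp.single_apply, @Pi.single_apply]
  congr!

theorem inner_delta (i : ι) (ξ : L2 ι) : inner ℂ (delta i) ξ = ξ i := by
  classical
  unfold delta
  rw [lp.inner_single_left]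
  simp

theorem hasSum_delta (ξ : L2 ι) : HasSum (fun i => ξ i • delta i) ξ := by
  classical
  convert lp.hasSum_single (p := 2) (by simp) ξ using 2 with i
  ext j
  rw [lp.coeFn_smul, Pi.smul_apply, delta_apply, lp.single_apply, Pi.single_apply]
  split_ifs with h
  · subst h; simp
  · simp

theorem clm_ext_delta {E : Type*} [NormedAddCommGroup E] [NormedSpace ℂ E] {A B : L2 ι →L[ℂ] E}
    (h : ∀ i, A (delta i) = B (delta i)) : A = B := by
  ext ξ
  have hA := A.hasSum (hasSum_delta ξ)
  have hB := B.hasSum (hasSum_delta ξ)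
  simp only [map_smul, h] at hA hB
  exact hA.unique hB

/-- A bound for an operator needs to be checked on finitely supported vectors only. -/
theorem opNorm_le_of_finite {E : Type*} [NormedAddCommGroup E] [NormedSpace ℂ E]
    {A : L2 ι →L[ℂ] E} {M : ℝ} (hM : 0 ≤ M)
    (h : ∀ (s : Finset ι) (z : ι → ℂ), ‖A (∑ i ∈ s, z i • delta i)‖ ≤ M * ‖∑ i ∈ s, z i • delta i‖) :
    ‖A‖ ≤ M := by
  refine A.opNorm_le_bound hM fun ξ => ?_
  have h1 := hasSum_delta ξ
  exact le_of_tendsto_of_tendsto' ((A.continuous.tendsto _).comp h1).norm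
    (h1.norm.const_mul M) fun s => h s _

theorem adjoint_delta_apply (A : L2 ι →L[ℂ] L2 ι) (i j : ι) :
    star A (delta i) j = star (A (delta j) i) := by
  rw [← inner_delta, ContinuousLinearMap.star_eq_adjoint, ContinuousLinearMap.adjoint_inner_right,
    ← inner_conj_symm, inner_delta]
  rfl

/-- The basis vector of an element of `ι`, or `0`. -/
noncomputable def deltaOpt (o : Option ι) : L2 ι := o.elim 0 delta

/-- The clause `o ≠ none` is needed because `none = none`, while the vector of an undefined index is
zero. -/
theorem inner_deltaOpt [DecidableEq ι] (o o' : Option ι) :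
    inner ℂ (deltaOpt o) (deltaOpt o') = if o = o' ∧ o ≠ none then (1 : ℂ) else 0 := by
  cases o with
  | none => simp [deltaOpt]
  | some i =>
    cases o' with
    | none => simp [deltaOpt]
    | some j => simp [deltaOpt, inner_delta, delta_apply]

/-- The norm of a combination of basis vectors depends only on which of them coincide. -/
theorem norm_sum_deltaOpt {α : Type*} (I : Finset α) (z : α → ℂ) (x : α → Option ι)
    (y : α → Option κ) (h : ∀ a ∈ I, ∀ b ∈ I, x a = x b ↔ y a = y b)
    (h0 : ∀ a ∈ I, x a = none ↔ y a = none) :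
    ‖∑ a ∈ I, z a • deltaOpt (x a)‖ = ‖∑ a ∈ I, z a • deltaOpt (y a)‖ := by
  classical
  -- The squared norm is a sum over the Gram matrix, whose entries only record coincidences and
  -- undefined indices.
  have key : inner ℂ (∑ a ∈ I, z a • deltaOpt (x a)) (∑ a ∈ I, z a • deltaOpt (x a)) =
      inner ℂ (∑ a ∈ I, z a • deltaOpt (y a)) (∑ a ∈ I, z a • deltaOpt (y a)) := by
    simp only [sum_inner, inner_sum, inner_smul_left, inner_smul_right, inner_deltaOpt]
    refine Finset.sum_congr rfl fun a ha => congrArg _ (Finset.sum_congr rfl fun b hb => ?_)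
    simp only [h b hb a ha, ne_eq, h0 b hb]
  rw [inner_self_eq_norm_sq_to_K, inner_self_eq_norm_sq_to_K] at key
  have key' : ‖∑ a ∈ I, z a • deltaOpt (x a)‖ ^ 2 = ‖∑ a ∈ I, z a • deltaOpt (y a)‖ ^ 2 := by
    exact_mod_cast key
  exact (sq_eq_sq₀ (norm_nonneg _) (norm_nonneg _)).1 key'

/-- The unitary `ℓ²(ι) → ℓ²(κ)` defined by a bijection `ι → κ`. -/
theorem exists_unitary_of_equiv (e : ι ≃ κ) :
    ∃ U : L2 ι ≃ₗᵢ[ℂ] L2 κ, ∀ i, U (delta i) = delta (e i) := by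
  classical
  have ho : Orthonormal ℂ fun i => (delta (e i) : L2 κ) := by
    rw [orthonormal_iff_ite]
    intro i j
    rw [inner_delta, delta_apply]
    simp
  have hd : ⊤ ≤ (Submodule.span ℂ (Set.range fun i => (delta (e i) : L2 κ))).topologicalClosure := by
    rintro ξ -
    refine mem_closure_of_tendsto (hasSum_delta ξ) (Filter.Eventually.of_forall fun s => ?_)
    refine Submodule.sum_mem _ fun j _ => Submodule.smul_mem _ _ (Submodule.subset_span ?_)
    exact ⟨e.symm j, by simp⟩
  refine ⟨(HilbertBasis.mk ho hd).repr.symm, fun i => ?_⟩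
  have := (HilbertBasis.mk ho hd).repr_symm_single i
  rw [HilbertBasis.coe_mk] at this
  rw [← this]
  unfold delta
  congr!

end Hilbert

/-! ### Matrix coefficients of ρ_x and the norm of functions on a bisection -/

section Kernel

variable {G X : Type*} [TopologicalSpace G] [TopologicalSpace X] [EtaleGroupoid G X]

open ArrowGroupoid

/-- The matrix of ρ_x(f) has entries f(ak⁻¹). Identities between such operators can thus be checked
entrywise, without handling infinite sums. -/
theorem rho_delta_apply (x : X) (f : Cc G) (k a : SrcFiber G x) :
    rho x f (delta k) a = (f : G → ℂ) (mul a.1 (inv k.1)) := by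
  classical
  change convFormula (f : G → ℂ) x (delta k) a = _
  rw [convFormula_eq, tsum_eq_single k]
  · simp [delta_apply]
  · intro j hj
    simp [delta_apply, hj]

theorem rho_add (x : X) (f f' : Cc G) : rho x (f + f') = rho x f + rho x f' :=
  clm_ext_delta fun k => by
    ext a
    rw [add_apply, lp.coeFn_add, Pi.add_apply]
    simp only [rho_delta_apply]
    rfl

theorem rho_smul (x : X) (c : ℂ) (f : Cc G) : rho x (c • f) = c • rho x f :=
  clm_ext_delta fun k => by
    ext a
    rw [smul_apply, lp.coeFn_smul, Pi.smul_apply]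
    simp only [rho_delta_apply]
    rfl

theorem OpProduct.ext {X : Type*} {ι : X → Type*} {a b : OpProduct ι}
    (h : ∀ x, OpProduct.eval x a = OpProduct.eval x b) : a = b :=
  lp.ext (funext h)

theorem OpProduct.norm_eval_le {X : Type*} {ι : X → Type*} (x : X) (a : OpProduct ι) :
    ‖OpProduct.eval x a‖ ≤ ‖a‖ :=
  lp.norm_apply_le_norm (E := fun x : X => L2 (ι x) →L[ℂ] L2 (ι x)) ENNReal.top_ne_zero a x

theorem OpProduct.norm_le {X : Type*} {ι : X → Type*} {a : OpProduct ι} {C : ℝ} (hC : 0 ≤ C)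
    (h : ∀ x, ‖OpProduct.eval x a‖ ≤ C) : ‖a‖ ≤ C :=
  lp.norm_le_of_forall_le (E := fun x : X => L2 (ι x) →L[ℂ] L2 (ι x)) hC h

variable (G) in
/-- The map `f ↦ (ρ_x(f))_x` as a linear map. -/
noncomputable def regularFamilyₗ : Cc G →ₗ[ℂ] OpProduct (SrcFiber G : X → Type _) where
  toFun := regularFamily
  map_add' f f' := OpProduct.ext fun x => by
    rw [map_add]
    exact rho_add x f f'
  map_smul' c f := OpProduct.ext fun x => by
    rw [RingHom.id_apply, map_smul]
    exact rho_smul x c f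

/-- On functions supported on a bisection the reduced norm is at most the supremum norm. -/
theorem norm_regularFamily_le {f : Cc G} {W : Set G} {C : ℝ} (hC : 0 ≤ C)
    (hs : Set.InjOn src W) (hr : Set.InjOn rng W) (h0 : ∀ g ∉ W, (f : G → ℂ) g = 0)
    (hf : ∀ g, ‖(f : G → ℂ) g‖ ≤ C) : ‖regularFamily f‖ ≤ C := by
  refine OpProduct.norm_le hC fun x => ContinuousLinearMap.opNorm_le_bound _ hC fun ξ => ?_
  refine lp.norm_le_of_forall_sum_le (by simp) (by positivity) fun s => ?_
  change ∑ i ∈ s, ‖convFormula (f : G → ℂ) x ξ i‖ ^ _ ≤ _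
  simp only [convFormula_eq]
  have hW : ∀ g, (f : G → ℂ) g ≠ 0 → g ∈ W := fun g hg => by
    by_contra h
    exact hg (h0 g h)
  have hc : ∀ g k : SrcFiber G x, src g.1 = rng (inv k.1) := fun g k => by
    rw [rng_inv, g.2, k.2]
  have aux : ∀ g k : SrcFiber G x, mul (mul g.1 (inv k.1)) k.1 = g.1 := fun g k => by
    rw [assoc _ _ _ (hc g k) (src_inv _), inverse_mul, k.2]
    have := mul_unit g.1
    rwa [g.2] at this
  -- The matrix has at most one nonzero entry in each row, as the range is injective on `W`, and in
  -- each column, as the source is; so `N = 1`.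
  refine (kernel_sum_le (fun g k : SrcFiber G x => (f : G → ℂ) (mul g.1 (inv k.1))) 1 C
    (fun _ _ => hf _) (fun g => ?_) (fun k => ?_) ξ s).trans (by simp)
  · refine Set.encard_le_one_iff.2 fun k k' hk hk' => ?_
    have := hr (hW _ hk) (hW _ hk') (by rw [rng_mul _ _ (hc g k), rng_mul _ _ (hc g k')])
    exact (fiberEquiv g).symm.injective (Subtype.ext this)
  · refine Set.encard_le_one_iff.2 fun g g' hg hg' => ?_
    have := hs (hW _ hg) (hW _ hg') (by rw [src_mul _ _ (hc g k), src_mul _ _ (hc g' k)])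
    exact Subtype.ext (by rw [← aux g k, this, aux])

end Kernel

/-! ### Germs at a point of Ω(S), and the fibre over χ_e -/

section Germs

variable {S : Type*} [LeftCancelMonoid S]

open Constructible ArrowGroupoid

theorem LeftHull.eq_none_iff {g : LeftHull S} {s : S} : g.1 s = none ↔ s ∉ (dom g).1 := by
  rw [mem_dom, Option.eq_none_iff_forall_ne_some, not_exists]

/-- Left and right translations commute, and this persists under composition and inversion. It is
the reason why the fibre over χ_e is a copy of S. -/
theorem LeftHull.apply_mul {g : S ≃. S} (hg : InLeftHull g) :
    ∀ {a b : S} (t : S), g a = some b → g (a * t) = some (b * t) := by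
  induction hg with
  | translation s =>
    intro a b t h
    obtain rfl : s * a = b := Option.some.inj h
    exact congrArg some (mul_assoc s a t).symm
  | trans _ _ ih ih' =>
    intro a b t h
    rw [PEquiv.trans_eq_some] at h ⊢
    obtain ⟨c, h1, h2⟩ := h
    exact ⟨c * t, ih t h1, ih' t h2⟩
  | symm _ ih =>
    intro a b t h
    rw [PEquiv.eq_some_iff] at h ⊢
    exact ih t h

theorem Omega.val_dom_congr {χ : Omega S} {g h : LeftHull S} (e : ∀ᶠ s in χ.near, g.1 s = h.1 s) :
    χ.val (dom g) = χ.val (dom h) :=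
  Omega.val_congr (e.mono fun s hs => by rw [mem_dom, mem_dom, hs])

/-- The condition χ(g⁻¹g) = 1 is clopen, so being undefined at χ is also detected on nearby points
of S. -/
theorem Omega.eventually_none {χ : Omega S} {g : LeftHull S} (h : ¬ χ.val (dom g) = true) :
    ∀ᶠ s in χ.near, g.1 s = none := by
  filter_upwards [χ.near_iff (dom g)] with s hs
  exact LeftHull.eq_none_iff.2 fun h' => h (hs.1 h')

theorem Omega.near_eq_none_iff (χ : Omega S) (g : LeftHull S) :
    ∀ᶠ s in χ.near, (g.1 s = none ↔ ¬ χ.val (dom g) = true) := by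
  filter_upwards [χ.near_iff (dom g)] with s hs
  rw [LeftHull.eq_none_iff, hs]

open Classical in
/-- The germ `[g, χ]` as an element of the fibre over `χ`, if it is defined. -/
noncomputable def germOpt (χ : Omega S) (g : LeftHull S) :
    Option (SrcFiber (GermGroupoid S) χ) :=
  if h : χ.val (dom g) = true then some ⟨germ g χ h, src_germ g χ h⟩ else none

theorem germOpt_of_mem {χ : Omega S} {g : LeftHull S} (h : χ.val (dom g) = true) :
    germOpt χ g = some ⟨germ g χ h, src_germ g χ h⟩ := dif_pos h

theorem germOpt_of_notMem {χ : Omega S} {g : LeftHull S} (h : ¬ χ.val (dom g) = true) :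
    germOpt χ g = none := dif_neg h

theorem germOpt_eq_none_iff {χ : Omega S} {g : LeftHull S} :
    germOpt χ g = none ↔ ¬ χ.val (dom g) = true := by
  refine ⟨fun h h' => ?_, germOpt_of_notMem⟩
  rw [germOpt_of_mem h'] at h
  exact Option.some_ne_none _ h

/-- Agreement near χ is agreement as partial maps, so it also covers the case where both germs are
undefined. -/
theorem germOpt_eq_iff {χ : Omega S} {g h : LeftHull S} :
    germOpt χ g = germOpt χ h ↔ ∀ᶠ s in χ.near, g.1 s = h.1 s := by
  constructor
  · intro e
    by_cases hg : χ.val (dom g) = true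
    · have hh : χ.val (dom h) = true := by
        by_contra hh
        rw [germOpt_of_notMem hh, germOpt_eq_none_iff] at e
        exact e hg
      rw [germOpt_of_mem hg, germOpt_of_mem hh, Option.some.injEq, Subtype.mk.injEq,
        germ_eq_iff] at e
      exact e.2
    · have hh : ¬ χ.val (dom h) = true := by
        rw [germOpt_of_notMem hg] at e
        exact germOpt_eq_none_iff.1 e.symm
      filter_upwards [Omega.eventually_none hg, Omega.eventually_none hh] with s h1 h2
      rw [h1, h2]
  · intro e
    have hd := Omega.val_dom_congr e
    by_cases hg : χ.val (dom g) = true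
    · rw [germOpt_of_mem hg, germOpt_of_mem (hd ▸ hg), Option.some.injEq, Subtype.mk.injEq]
      exact (germ_eq_iff _ _).2 ⟨rfl, e⟩
    · rw [germOpt_of_notMem hg, germOpt_of_notMem (hd ▸ hg)]

theorem exists_germOpt {χ : Omega S} (k : SrcFiber (GermGroupoid S) χ) :
    ∃ g, germOpt χ g = some k := by
  obtain ⟨k, hk⟩ := k
  obtain ⟨g, ψ, h, rfl⟩ := exists_germ k
  obtain rfl : ψ = χ := hk
  exact ⟨g, germOpt_of_mem h⟩

/-- Every neighbourhood of χ_s contains χ_s, so s itself lies in every set of the filter. -/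
theorem Omega.eventually_near_point {p : S → Prop} {s : S}
    (h : ∀ᶠ t in (Omega.point s).near, p t) : p s := by
  obtain ⟨W, hW, hWp⟩ := Filter.mem_comap.1 h
  exact hWp (mem_of_mem_nhds hW : charAt s ∈ W)

/-- If g(e) = b, then g(t) = bt for all t ∈ S, so two elements with the same value at e agree on all
of S. If both are undefined at e, they are undefined near χ_e. -/
theorem germOpt_point_one_eq_iff {g h : LeftHull S} :
    germOpt (Omega.point 1) g = germOpt (Omega.point 1) h ↔ g.1 1 = h.1 1 := by
  rw [germOpt_eq_iff]
  refine ⟨Omega.eventually_near_point, fun e => ?_⟩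
  cases hg : g.1 1 with
  | none =>
    have hd : ∀ {g : LeftHull S}, g.1 1 = none → ¬ (Omega.point (1 : S)).val (dom g) = true :=
      fun h => by rwa [Omega.val_point, ← LeftHull.eq_none_iff]
    filter_upwards [Omega.eventually_none (hd hg), Omega.eventually_none (hd (e ▸ hg))]
      with s h1 h2
    rw [h1, h2]
  | some b =>
    refine Filter.Eventually.of_forall fun t => ?_
    have h1 := LeftHull.apply_mul g.2 t hg
    have h2 := LeftHull.apply_mul h.2 t (e ▸ hg)
    rw [one_mul] at h1 h2
    rw [h1, h2]

theorem germOpt_point_one_eq_none_iff {g : LeftHull S} :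
    germOpt (Omega.point 1) g = none ↔ g.1 1 = none := by
  rw [germOpt_eq_none_iff, Omega.val_point, LeftHull.eq_none_iff]

theorem ofElem_apply (s t : S) : (LeftHull.ofElem s).1 t = some (s * t) := rfl

theorem germOpt_ofElem (s : S) :
    germOpt (Omega.point 1) (LeftHull.ofElem s) = some (baseArrow s) :=
  germOpt_of_mem _

theorem germOpt_point_one_eq_some_iff {g : LeftHull S} {s : S} :
    germOpt (Omega.point 1) g = some (baseArrow s) ↔ g.1 1 = some s := by
  rw [← germOpt_ofElem, germOpt_point_one_eq_iff, ofElem_apply, mul_one]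

/-- The inverse map is [g,χ_e] ↦ g(e). This bijection induces the unitary U. -/
theorem baseArrow_bijective : Function.Bijective (baseArrow (S := S)) := by
  constructor
  · intro s t h
    have h1 := congrArg some h
    rw [← germOpt_ofElem, germOpt_point_one_eq_some_iff, ofElem_apply, mul_one] at h1
    exact Option.some.inj h1
  · intro k
    obtain ⟨g, hg⟩ := exists_germOpt k
    cases h : g.1 1 with
    | none =>
      rw [germOpt_point_one_eq_none_iff.2 h] at hg
      exact absurd hg.symm (Option.some_ne_none _)
    | some s =>
      rw [germOpt_point_one_eq_some_iff.2 h] at hg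
      exact ⟨s, Option.some.inj hg⟩

theorem mul_inv_germ {g h : LeftHull S} {χ : Omega S} (hg : χ.val (dom g) = true)
    (hh : χ.val (dom h) = true) :
    ∃ hm, mul (germ g χ hg) (inv (germ h χ hh)) = germ (g.comp h.inv) (act h χ hh) hm := by
  -- The base point is generalized because χ equals h⁻¹(hχ) only propositionally, while `mul_germ`
  -- needs the literal form.
  have key : ∀ ψ (hψ : ψ = act h.inv (act h χ hh) (act_inv_mem hh)) (hg' : ψ.val (dom g) = true),
      ∃ hm, mul (germ g ψ hg') (inv (germ h χ hh)) = germ (g.comp h.inv) (act h χ hh) hm := by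
    rintro _ rfl hg'
    exact ⟨_, mul_germ g h.inv (act h χ hh) (act_inv_mem hh) hg'⟩
  exact key χ (act_inv_act hh).symm hg

/-- `[h', χ] [h, χ]⁻¹` belongs to `D(g)` if and only if `[gh, χ] = [h', χ]`. -/
theorem mul_inv_mem_germSet_iff {g h h' : LeftHull S} {χ : Omega S} (hh : χ.val (dom h) = true)
    (hh' : χ.val (dom h') = true) :
    mul (germ h' χ hh') (inv (germ h χ hh)) ∈ germSet g Set.univ ↔
      germOpt χ (g.comp h) = germOpt χ h' := by
  obtain ⟨hm, e⟩ := mul_inv_germ hh' hh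
  rw [e, germOpt_eq_iff]
  -- The substitution t = h(s) carries points near χ to points near the range of [h,χ], and back.
  have hnear : (∀ᶠ t in (act h χ hh).near, g.1 t = (h'.comp h.inv).1 t) ↔
      ∀ᶠ s in χ.near, (g.comp h).1 s = h'.1 s := by
    have aux : ∀ {s t : S}, h.1 s = some t →
        (g.1 t = (h'.comp h.inv).1 t ↔ (g.comp h).1 s = h'.1 s) := fun {s t} hst => by
      have h1 : (g.comp h).1 s = g.1 t := by
        change (h.1 s).bind _ = _
        rw [hst]
        rfl
      have h2 : (h'.comp h.inv).1 t = h'.1 s := by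
        change (h.1.symm t).bind _ = _
        rw [(PEquiv.eq_some_iff h.1).2 hst]
        rfl
      rw [h1, h2]
    constructor
    · intro H
      filter_upwards [near_act hh H] with s ⟨t, hst, h1⟩
      exact (aux hst).1 h1
    · intro H
      filter_upwards [near_act_inv hh H] with t ⟨s, hst, h1⟩
      exact (aux hst).2 h1
  rw [← hnear]
  constructor
  · rintro ⟨ψ, -, hψ, e'⟩
    obtain ⟨rfl, e2⟩ := (germ_eq_iff _ _).1 e'
    exact e2
  · intro H
    have hd := Omega.val_dom_congr H
    exact ⟨_, trivial, hd.trans hm, (germ_eq_iff _ _).2 ⟨rfl, H⟩⟩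

end Germs

/-! ### C*-regularity and points that separate germs -/

section Generic

variable {S : Type*} [LeftCancelMonoid S]

open Constructible

/-- χ decides every constructible ideal, hence every difference of such: the filter `χ.near` behaves
like an ultrafilter on J̄(S). -/
theorem Omega.eventually_mem_or_notMem (χ : Omega S) {A : Set S} (hA : A ∈ barConstructible S) :
    (∀ᶠ s in χ.near, s ∈ A) ∨ ∀ᶠ s in χ.near, s ∉ A := by
  obtain ⟨X, F, rfl⟩ := hA
  by_cases h : χ.val X = true ∧ ∀ Y ∈ F, χ.val Y = false
  · exact Or.inl (Omega.barOne_mem_near ⟨X, F, rfl, h.1, h.2⟩)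
  · right
    by_cases hX : χ.val X = true
    · obtain ⟨Y, hY, hY'⟩ : ∃ Y ∈ F, χ.val Y = true := by
        by_contra hne
        push Not at hne
        exact h ⟨hX, fun Y hY => by simpa using hne Y hY⟩
      filter_upwards [χ.near_iff Y] with s hs hsA
      refine hsA.2 ?_
      simp only [Set.mem_iUnion]
      exact ⟨Y, hY, hs.2 hY'⟩
    · filter_upwards [χ.near_iff X] with s hs hsA
      exact hX (hs.1 hsA.1)

/-- If `S` is C*-regular, then near every `χ ∈ Ω(S)` there are points of `S` that distinguish all
germs at `χ` of finitely many elements of `I_ℓ(S)`. -/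
theorem IsCStarRegular.exists_generic (hS : IsCStarRegular S) (χ : Omega S)
    (T : Finset (LeftHull S)) : ∃ s : S,
      (∀ g ∈ T, g.1 s = none ↔ germOpt χ g = none) ∧
      ∀ g ∈ T, ∀ h ∈ T, g.1 s = h.1 s ↔ germOpt χ g = germOpt χ h := by
  classical
  -- The pairs that must be kept apart. Definedness and equality of germs persist near χ
  -- automatically; inequality alone requires regularity.
  set bad := (T ×ˢ T).filter fun p => ¬ germOpt χ p.1 = germOpt χ p.2
  have hdom : ∀ᶠ s in χ.near, ∀ g ∈ T, (g.1 s = none ↔ germOpt χ g = none) := by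
    rw [Filter.eventually_all_finset]
    intro g _
    simpa only [germOpt_eq_none_iff] using χ.near_eq_none_iff g
  have hgood : ∀ᶠ s in χ.near, ∀ p ∈ T ×ˢ T, germOpt χ p.1 = germOpt χ p.2 → p.1.1 s = p.2.1 s := by
    rw [Filter.eventually_all_finset]
    intro p _
    by_cases h : germOpt χ p.1 = germOpt χ p.2
    · exact (germOpt_eq_iff.1 h).mono fun s hs _ => hs
    · exact Filter.Eventually.of_forall fun s h' => absurd h' h
  obtain ⟨A, hA, hAp⟩ := Omega.exists_barOne (hdom.and hgood)
  have hAn := Omega.barOne_mem_near hA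
  by_contra hcon
  push Not at hcon
  -- For a bad pair (g,g'), the map g'⁻¹g fixes exactly the points where g and g' are both defined
  -- and agree.
  let h : Fin bad.card → LeftHull S := fun k =>
    (bad.equivFin.symm k).1.2.inv.comp (bad.equivFin.symm k).1.1
  have hcov : A ⊆ ⋃ k, {s | (h k).1 s = some s} := by
    intro s hs
    obtain ⟨h1, h2⟩ := hAp s hs
    obtain ⟨g, hg, g', hg', hne⟩ := hcon s h1
    have hne' : g.1 s = g'.1 s ∧ germOpt χ g ≠ germOpt χ g' := by
      rcases hne with hne | hne
      · exact hne
      · exact absurd (h2 (g, g') (Finset.mk_mem_product hg hg') hne.2) hne.1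
    have hmem : (g, g') ∈ bad := Finset.mem_filter.2 ⟨Finset.mk_mem_product hg hg', hne'.2⟩
    refine Set.mem_iUnion.2 ⟨bad.equivFin ⟨_, hmem⟩, ?_⟩
    simp only [h, Set.mem_ofPred_eq, Equiv.symm_apply_apply]
    cases e : g.1 s with
    -- If both values were undefined at s, both germs would be undefined at χ and hence equal.
    | none =>
      have e' := hne'.1 ▸ e
      exact absurd (((h1 g hg).1 e).trans ((h1 g' hg').1 e').symm) hne'.2
    | some t => exact comp_apply_eq_some.2 ⟨t, e, (PEquiv.eq_some_iff g'.1).2 (hne'.1 ▸ e)⟩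
  obtain ⟨X, F, rfl, -, -⟩ := id hA
  -- The set is nonempty because it belongs to the proper filter `χ.near`.
  obtain ⟨l, Y, k, hY, hAY, hfix⟩ := hS _ h _ ⟨X, F, rfl⟩ hAn.exists hcov
  -- Each Y_j is decided by χ, and finitely many sets not containing the points near χ could not
  -- cover A.
  have hj : ∃ j, ∀ᶠ s in χ.near, s ∈ Y j := by
    by_contra hno
    rw [not_exists] at hno
    have : ∀ᶠ s in χ.near, ∀ j, s ∉ Y j := by
      rw [Filter.eventually_all]
      exact fun j => (χ.eventually_mem_or_notMem (hY j)).resolve_left (hno j)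
    obtain ⟨s, h1, h2⟩ := (this.and hAn).exists
    obtain ⟨j, hj⟩ := Set.mem_iUnion.1 (hAY h2)
    exact h1 j hj
  obtain ⟨j, hj⟩ := hj
  -- On this Y_j the map g'⁻¹g is the identity, so g = g' near χ, although the pair is bad.
  refine (Finset.mem_filter.1 (bad.equivFin.symm (k j)).2).2 (germOpt_eq_iff.2 ?_)
  filter_upwards [hj] with s hs
  obtain ⟨t, h1, h2⟩ := comp_apply_eq_some.1 (hfix j s hs)
  exact h1.trans ((PEquiv.eq_some_iff _).1 h2).symm

end Generic

/-! ### The compact open bisections D(g) and the algebra of their indicators -/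

section Bisections

variable {S : Type*} [LeftCancelMonoid S]

open Constructible ArrowGroupoid

theorem injOn_src_germSet (g : LeftHull S) :
    Set.InjOn (src : GermGroupoid S → Omega S) (germSet g Set.univ) := by
  rintro _ ⟨χ, -, hχ, rfl⟩ _ ⟨ψ, -, hψ, rfl⟩ (e : χ = ψ)
  subst e
  rfl

/-- The source of an arrow of D(g) is recovered from its range by acting with g⁻¹. -/
theorem injOn_rng_germSet (g : LeftHull S) :
    Set.InjOn (rng : GermGroupoid S → Omega S) (germSet g Set.univ) := by
  rintro _ ⟨χ, -, hχ, rfl⟩ _ ⟨ψ, -, hψ, rfl⟩ (e : act g χ hχ = act g ψ hψ)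
  have key : ∀ η (hη : η = act g χ hχ) (h : η.val (dom g.inv) = true), act g.inv η h = χ := by
    rintro _ rfl h
    exact act_inv_act hχ
  obtain rfl : ψ = χ := by
    rw [← act_inv_act hψ]
    exact key _ e.symm _
  rfl

theorem t2Space_germSet (g : LeftHull S) : T2Space (germSet g (Set.univ : Set (Omega S))) :=
  T2Space.of_injective_continuous (f := fun a : germSet g Set.univ => src a.1)
    (injOn_src_germSet g).injective (continuous_src.comp continuous_subtype_val)

theorem germSet_eq_image (g : LeftHull S) (C : Set (Omega S)) :
    germSet g C = sec g '' (Subtype.val ⁻¹' C) := by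
  ext a
  constructor
  · rintro ⟨χ, hC, h, rfl⟩
    exact ⟨⟨χ, h⟩, hC, rfl⟩
  · rintro ⟨χ, hC, rfl⟩
    exact ⟨χ.1, hC, χ.2, rfl⟩

theorem isClosed_dom (g : LeftHull S) : IsClosed {χ : Omega S | χ.val (dom g) = true} :=
  (isClosed_discrete {true}).preimage (Omega.continuous_val (dom g))

/-- The domain of the section χ ↦ [g,χ] is closed in the compact space Ω(S). This makes indicators
of D(g) elements of C_c. -/
theorem isCompact_germSet (g : LeftHull S) {C : Set (Omega S)} (hC : IsClosed C) :
    IsCompact (germSet g C) := by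
  have : CompactSpace (DomSpace g) := isCompact_iff_compactSpace.1 (isClosed_dom g).isCompact
  rw [germSet_eq_image]
  exact (hC.preimage continuous_subtype_val).isCompact.image (continuous_sec g)

open Classical in
/-- The function `φ ∘ src` on `D(g)`, extended by zero. -/
noncomputable def bisectionFun (g : LeftHull S) (φ : C(Omega S, ℂ)) (a : GermGroupoid S) : ℂ :=
  if a ∈ germSet g Set.univ then φ (src a) else 0

theorem isBasicCc_bisectionFun (g : LeftHull S) (φ : C(Omega S, ℂ)) :
    IsBasicCc (bisectionFun g φ) := by
  refine ⟨germSet g Set.univ, isOpen_germSet g isOpen_univ, t2Space_germSet g, ?_,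
    germSet g Set.univ, isCompact_germSet g isClosed_univ, subset_rfl, fun a ha => if_neg ha⟩
  exact (φ.continuous.comp continuous_src).continuousOn.congr fun a ha => if_pos ha

/-- The element of `C_c(𝒢(S))` given by `φ ∘ src` on `D(g)`. -/
noncomputable def bisectionCc (g : LeftHull S) : C(Omega S, ℂ) →ₗ[ℂ] Cc (GermGroupoid S) where
  toFun φ := ⟨bisectionFun g φ, Submodule.subset_span (isBasicCc_bisectionFun g φ)⟩
  map_add' φ ψ := Subtype.ext (funext fun a => by
    by_cases h : a ∈ germSet g Set.univ <;> simp [bisectionFun, h])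
  map_smul' c φ := Subtype.ext (funext fun a => by
    by_cases h : a ∈ germSet g Set.univ <;> simp [bisectionFun, h])

theorem bisectionCc_apply (g : LeftHull S) (φ : C(Omega S, ℂ)) (a : GermGroupoid S) :
    (bisectionCc g φ : GermGroupoid S → ℂ) a = bisectionFun g φ a := rfl

theorem norm_regularFamily_bisectionCc_le (g : LeftHull S) (φ : C(Omega S, ℂ)) :
    ‖regularFamily (bisectionCc g φ)‖ ≤ ‖φ‖ := by
  refine norm_regularFamily_le (norm_nonneg φ) (injOn_src_germSet g) (injOn_rng_germSet g)
    (fun a ha => if_neg ha) fun a => ?_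
  rw [bisectionCc_apply, bisectionFun]
  split_ifs
  · exact φ.norm_coe_le_norm _
  · simp

/-- The indicator function of `D(g)` as an element of `C*_r(𝒢(S))`. -/
noncomputable def indicatorElem (g : LeftHull S) :
    OpProduct (SrcFiber (GermGroupoid S) : Omega S → Type _) :=
  regularFamily (bisectionCc g 1)

theorem deltaOpt_apply {ι : Type*} [DecidableEq ι] (o : Option ι) (k : ι) :
    (deltaOpt o : L2 ι) k = if o = some k then 1 else 0 := by
  rw [← inner_delta]
  change inner ℂ (deltaOpt (some k)) _ = _
  rw [inner_deltaOpt]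
  simp [eq_comm]

theorem deltaOpt_some {ι : Type*} (i : ι) : (deltaOpt (some i) : L2 ι) = delta i := rfl

theorem comp_apply (g h : LeftHull S) (s : S) : (g.comp h).1 s = (h.1 s).bind g.1 := rfl

theorem germOpt_comp_of_notMem {χ : Omega S} (g : LeftHull S) {h : LeftHull S}
    (hh : ¬ χ.val (dom h) = true) : germOpt χ (g.comp h) = none := by
  rw [← germOpt_of_notMem hh, germOpt_eq_iff]
  filter_upwards [Omega.eventually_none hh] with s hs
  rw [comp_apply, hs, Option.bind_none]

/-- The entry at ([h',χ],[h,χ]) is 1 exactly when [h',χ][h,χ]⁻¹ ∈ D(g), that is, when [h',χ] =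
[gh,χ]. With undefined germs sent to 0, no case distinction is left in the formula. -/
theorem eval_indicatorElem_deltaOpt (χ : Omega S) (g h : LeftHull S) :
    OpProduct.eval χ (indicatorElem g) (deltaOpt (germOpt χ h)) =
      deltaOpt (germOpt χ (g.comp h)) := by
  classical
  by_cases hh : χ.val (dom h) = true
  · ext ⟨a, ha⟩
    obtain ⟨h', ψ, hh', rfl⟩ := exists_germ a
    obtain rfl : ψ = χ := ha
    have h1 : OpProduct.eval ψ (indicatorElem g) (deltaOpt (germOpt ψ h))
        ⟨germ h' ψ hh', src_germ _ _ _⟩ =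
        bisectionFun g 1 (mul (germ h' ψ hh') (inv (germ h ψ hh))) := by
      rw [germOpt_of_mem hh]
      exact rho_delta_apply _ _ _ _
    refine h1.trans ?_
    rw [deltaOpt_apply, ← germOpt_of_mem hh', bisectionFun]
    simp only [mul_inv_mem_germSet_iff hh hh', ContinuousMap.one_apply]
  · rw [germOpt_of_notMem hh, germOpt_comp_of_notMem g hh]
    exact map_zero _

theorem indicatorElem_comp (g h : LeftHull S) :
    indicatorElem (g.comp h) = indicatorElem g * indicatorElem h := by
  refine OpProduct.ext fun χ => clm_ext_delta fun k => ?_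
  obtain ⟨h', hk⟩ := exists_germOpt k
  rw [← deltaOpt_some, ← hk, map_mul, ContinuousLinearMap.mul_def,
    ContinuousLinearMap.comp_apply, eval_indicatorElem_deltaOpt,
    eval_indicatorElem_deltaOpt, eval_indicatorElem_deltaOpt]
  exact congrArg (fun g => deltaOpt (germOpt χ g)) (Subtype.ext (PEquiv.trans_assoc _ _ _).symm)

/-- In terms of matrix entries: [g⁻¹h,χ] = [h',χ] if and only if [gh',χ] = [h,χ]. -/
theorem indicatorElem_inv (g : LeftHull S) : indicatorElem g.inv = star (indicatorElem g) := by
  classical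
  refine OpProduct.ext fun χ => clm_ext_delta fun k => ?_
  ext a
  obtain ⟨h, hk⟩ := exists_germOpt k
  obtain ⟨h', ha⟩ := exists_germOpt a
  have hd : ∀ {g : LeftHull S} {k : SrcFiber (GermGroupoid S) χ}, germOpt χ g = some k →
      χ.val (dom g) = true := fun {g k} e => by
    by_contra hne
    rw [germOpt_of_notMem hne] at e
    exact Option.some_ne_none _ e.symm
  rw [map_star, adjoint_delta_apply, ← deltaOpt_some, ← deltaOpt_some, ← hk, ← ha,
    eval_indicatorElem_deltaOpt, eval_indicatorElem_deltaOpt, deltaOpt_apply, deltaOpt_apply,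
    ← hk, ← ha]
  have : (∀ᶠ s in χ.near, (g.inv.comp h).1 s = h'.1 s) ↔
      ∀ᶠ s in χ.near, (g.comp h').1 s = h.1 s := by
    refine Filter.eventually_congr ?_
    filter_upwards [Omega.near_dom (hd hk), Omega.near_dom (hd ha)] with s ⟨t, ht⟩ ⟨t', ht'⟩
    rw [comp_apply, comp_apply, ht, ht']
    exact PEquiv.eq_some_iff g.1
  rw [← germOpt_eq_iff, ← germOpt_eq_iff] at this
  simp only [this]
  split_ifs <;> simp

/-- The linear span of the indicator functions of the sets `D(g)`. -/
noncomputable def indicatorSpan :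
    NonUnitalStarSubalgebra ℂ (OpProduct (SrcFiber (GermGroupoid S) : Omega S → Type _)) where
  __ := Submodule.span ℂ (Set.range (indicatorElem (S := S)))
  mul_mem' {a b} ha hb := by
    change a ∈ Submodule.span ℂ _ at ha
    change b ∈ Submodule.span ℂ _ at hb
    change a * b ∈ Submodule.span ℂ _
    induction ha using Submodule.span_induction with
    | zero => rw [zero_mul]; exact zero_mem _
    | add x y _ _ hx hy => rw [add_mul]; exact add_mem hx hy
    | smul c x _ hx => rw [smul_mul_assoc]; exact Submodule.smul_mem _ c hx
    | mem x hx =>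
      obtain ⟨g, rfl⟩ := hx
      induction hb using Submodule.span_induction with
      | zero => rw [mul_zero]; exact zero_mem _
      | add x y _ _ hx hy => rw [mul_add]; exact add_mem hx hy
      | smul c x _ hx => rw [mul_smul_comm]; exact Submodule.smul_mem _ c hx
      | mem y hy =>
        obtain ⟨h, rfl⟩ := hy
        rw [← indicatorElem_comp]
        exact Submodule.subset_span ⟨_, rfl⟩
  star_mem' {a} ha := by
    change a ∈ Submodule.span ℂ _ at ha
    change star a ∈ Submodule.span ℂ _
    induction ha using Submodule.span_induction with
    | zero => rw [star_zero]; exact zero_mem _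
    | add x y _ _ hx hy => rw [star_add]; exact add_mem hx hy
    | smul c x _ hx => rw [star_smul]; exact Submodule.smul_mem _ _ hx
    | mem x hx =>
      obtain ⟨g, rfl⟩ := hx
      rw [← indicatorElem_inv]
      exact Submodule.subset_span ⟨_, rfl⟩

theorem mem_indicatorSpan {a : OpProduct (SrcFiber (GermGroupoid S) : Omega S → Type _)} :
    a ∈ indicatorSpan ↔ a ∈ Submodule.span ℂ (Set.range (indicatorElem (S := S))) := Iff.rfl

end Bisections

/-! ### Stone–Weierstrass on Ω(S) -/

section Density

variable {S : Type*} [LeftCancelMonoid S]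

open Constructible ArrowGroupoid

/-- The function `χ ↦ χ(p_X)` on `Ω(S)`. -/
noncomputable def valFun (X : Constructible S) : C(Omega S, ℂ) where
  toFun χ := if χ.val X = true then 1 else 0
  continuous_toFun :=
    (continuous_of_discreteTopology (f := fun b : Bool => if b = true then (1 : ℂ) else 0)).comp
      (Omega.continuous_val X)

theorem valFun_apply (X : Constructible S) (χ : Omega S) :
    valFun X χ = if χ.val X = true then 1 else 0 := rfl

theorem valFun_inter (X Y : Constructible S) : valFun (inter X Y) = valFun X * valFun Y := by
  ext χ
  rw [ContinuousMap.mul_apply, valFun_apply, valFun_apply, valFun_apply, Omega.val_inter]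
  cases χ.val X <;> cases χ.val Y <;> simp

theorem valFun_top : valFun (top S) = 1 := by
  ext χ
  simp [valFun_apply, Omega.val_top]

/-- The linear span of the functions `χ ↦ χ(p_X)`. -/
noncomputable def valSpan : StarSubalgebra ℂ C(Omega S, ℂ) where
  __ := Submodule.span ℂ (Set.range (valFun (S := S)))
  mul_mem' {a b} ha hb := by
    change a ∈ Submodule.span ℂ _ at ha
    change b ∈ Submodule.span ℂ _ at hb
    change a * b ∈ Submodule.span ℂ _
    induction ha using Submodule.span_induction with
    | zero => rw [zero_mul]; exact zero_mem _
    | add x y _ _ hx hy => rw [add_mul]; exact add_mem hx hy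
    | smul c x _ hx => rw [smul_mul_assoc]; exact Submodule.smul_mem _ c hx
    | mem x hx =>
      obtain ⟨X, rfl⟩ := hx
      induction hb using Submodule.span_induction with
      | zero => rw [mul_zero]; exact zero_mem _
      | add x y _ _ hx hy => rw [mul_add]; exact add_mem hx hy
      | smul c x _ hx => rw [mul_smul_comm]; exact Submodule.smul_mem _ c hx
      | mem y hy =>
        obtain ⟨Y, rfl⟩ := hy
        rw [← valFun_inter]
        exact Submodule.subset_span ⟨_, rfl⟩
  star_mem' {a} ha := by
    change a ∈ Submodule.span ℂ _ at ha
    change star a ∈ Submodule.span ℂ _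
    induction ha using Submodule.span_induction with
    | zero => rw [star_zero]; exact zero_mem _
    | add x y _ _ hx hy => rw [star_add]; exact add_mem hx hy
    | smul c x _ hx => rw [star_smul]; exact Submodule.smul_mem _ _ hx
    | mem x hx =>
      obtain ⟨X, rfl⟩ := hx
      have : star (valFun X) = valFun X := by
        ext χ
        rw [ContinuousMap.star_apply, valFun_apply]
        split_ifs <;> simp
      rw [this]
      exact Submodule.subset_span ⟨_, rfl⟩
  algebraMap_mem' c := by
    change algebraMap ℂ C(Omega S, ℂ) c ∈ Submodule.span ℂ _
    rw [Algebra.algebraMap_eq_smul_one, ← valFun_top]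
    exact Submodule.smul_mem _ _ (Submodule.subset_span ⟨_, rfl⟩)

/-- Stone–Weierstrass applies because characters are by definition separated by their values on
constructible ideals. -/
theorem valSpan_dense : (valSpan (S := S)).topologicalClosure = ⊤ := by
  refine ContinuousMap.starSubalgebra_topologicalClosure_eq_top_of_separatesPoints _ ?_
  intro χ ψ hne
  obtain ⟨X, hX⟩ : ∃ X, χ.val X ≠ ψ.val X := by
    by_contra h
    push Not at h
    exact hne (Omega.ext h)
  refine ⟨_, ⟨valFun X, Submodule.subset_span ⟨X, rfl⟩, rfl⟩, ?_⟩
  change valFun X χ ≠ valFun X ψ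
  rw [valFun_apply, valFun_apply]
  cases h1 : χ.val X <;> cases h2 : ψ.val X <;> simp_all

/-- The restriction `g p_X` of `g` to `X`. -/
noncomputable def LeftHull.restrict (g : LeftHull S) (X : Constructible S) : LeftHull S :=
  g.comp ⟨idOn X.1, X.2⟩

theorem idOn_apply_of_mem {T : Type*} {X : Set T} {s : T} (h : s ∈ X) : idOn X s = some s :=
  idOn_eq_some_iff.2 ⟨rfl, h⟩

theorem LeftHull.restrict_apply {g : LeftHull S} {X : Constructible S} {s : S} (h : s ∈ X.1) :
    (g.restrict X).1 s = g.1 s := by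
  refine (comp_apply _ _ _).trans ?_
  change (idOn X.1 s).bind _ = _
  rw [idOn_apply_of_mem h]
  rfl

theorem LeftHull.val_dom_restrict (g : LeftHull S) (X : Constructible S) (χ : Omega S) :
    χ.val (dom (g.restrict X)) = true ↔ χ.val (dom g) = true ∧ χ.val X = true := by
  have : dom (g.restrict X) = inter (dom g) X := Subtype.ext (Set.ext fun s => by
    change s ∈ (dom (g.restrict X)).1 ↔ s ∈ (dom g).1 ∧ s ∈ X.1
    rw [mem_dom, mem_dom]
    constructor
    · rintro ⟨t, ht⟩
      obtain ⟨u, h1, h2⟩ := comp_apply_eq_some.1 ht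
      obtain ⟨rfl, h3⟩ := idOn_eq_some_iff.1 h1
      exact ⟨⟨t, h2⟩, h3⟩
    · rintro ⟨⟨t, ht⟩, h⟩
      exact ⟨t, by rw [LeftHull.restrict_apply h, ht]⟩)
  rw [this, Omega.val_inter, Bool.and_eq_true]

/-- Near a χ with χ(p_X) = 1 the maps g and gp_X agree, so D(gp_X) is the part of D(g) lying over
such χ. -/
theorem bisectionCc_valFun (g : LeftHull S) (X : Constructible S) :
    bisectionCc g (valFun X) = bisectionCc (g.restrict X) 1 := by
  refine Subtype.ext (funext fun a => ?_)
  rw [bisectionCc_apply, bisectionCc_apply, bisectionFun, bisectionFun, valFun_apply]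
  have : a ∈ germSet (g.restrict X) Set.univ ↔
      a ∈ germSet g Set.univ ∧ (src a).val X = true := by
    have hnear : ∀ χ : Omega S, χ.val X = true →
        ∀ᶠ s in χ.near, (g.restrict X).1 s = g.1 s := fun χ hX => by
      filter_upwards [χ.near_iff X] with s hs
      exact LeftHull.restrict_apply (hs.2 hX)
    constructor
    · rintro ⟨χ, -, hχ, rfl⟩
      obtain ⟨h1, h2⟩ := (LeftHull.val_dom_restrict g X χ).1 hχ
      exact ⟨⟨χ, trivial, h1, ((germ_eq_iff _ _).2 ⟨rfl, hnear χ h2⟩).symm⟩, h2⟩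
    · rintro ⟨⟨χ, -, hχ, rfl⟩, h2 : χ.val X = true⟩
      exact ⟨χ, trivial, (LeftHull.val_dom_restrict g X χ).2 ⟨hχ, h2⟩,
        (germ_eq_iff _ _).2 ⟨rfl, hnear χ h2⟩⟩
  simp only [this, ContinuousMap.one_apply]
  split_ifs <;> simp_all

/-- For fixed g the assignment is contractive in φ and sends χ ↦ χ(p_X) to the indicator of D(gp_X),
so density in C(Ω(S)) transfers. -/
theorem regularFamily_bisectionCc_mem (g : LeftHull S) (φ : C(Omega S, ℂ)) :
    regularFamily (bisectionCc g φ) ∈ (indicatorSpan (S := S)).topologicalClosure := by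
  let L : C(Omega S, ℂ) →L[ℂ] OpProduct (SrcFiber (GermGroupoid S) : Omega S → Type _) :=
    LinearMap.mkContinuous (regularFamilyₗ (GermGroupoid S) ∘ₗ bisectionCc g) 1 fun φ => by
      exact (norm_regularFamily_bisectionCc_le g φ).trans_eq (one_mul _).symm
  have hφ : φ ∈ closure (valSpan (S := S) : Set C(Omega S, ℂ)) := by
    have : φ ∈ (valSpan (S := S)).topologicalClosure := by
      rw [valSpan_dense]
      exact StarSubalgebra.mem_top
    exact this
  change L φ ∈ closure (indicatorSpan (S := S) : Set _)
  refine map_mem_closure L.continuous hφ fun ψ hψ => ?_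
  change ψ ∈ Submodule.span ℂ _ at hψ
  change L ψ ∈ Submodule.span ℂ _
  induction hψ using Submodule.span_induction with
  | zero => rw [map_zero]; exact zero_mem _
  | add x y _ _ hx hy => rw [map_add]; exact add_mem hx hy
  | smul c x _ hx => rw [map_smul]; exact Submodule.smul_mem _ c hx
  | mem x hx =>
    obtain ⟨X, rfl⟩ := hx
    refine Submodule.subset_span ⟨g.restrict X, ?_⟩
    change _ = regularFamily (bisectionCc g (valFun X))
    rw [bisectionCc_valFun]
    rfl

end Density

/-! ### Decomposing functions in C_c along bisections -/

section Partition

variable {S : Type*} [LeftCancelMonoid S]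

open Constructible ArrowGroupoid

instance : TotallyDisconnectedSpace (Semicharacter S) :=
  inferInstanceAs (TotallyDisconnectedSpace {χ : Constructible S → Bool //
    (∃ X, χ X = true) ∧ ∀ X Y, χ (inter X Y) = (χ X && χ Y)})

instance : TotallyDisconnectedSpace (Omega S) :=
  inferInstanceAs (TotallyDisconnectedSpace
    {χ : Semicharacter S // χ ∈ closure (Set.range (charAt (S := S)))})

/-- Ω(S) is compact, Hausdorff and totally disconnected, so its clopen sets form a basis. -/
theorem exists_germSet_subset {V : Set (GermGroupoid S)} (hV : IsOpen V) {a : GermGroupoid S}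
    (ha : a ∈ V) : ∃ (g : LeftHull S) (C : Set (Omega S)), IsClopen C ∧ a ∈ germSet g C ∧
      germSet g C ⊆ V := by
  obtain ⟨g, χ, h, rfl⟩ := exists_germ a
  obtain ⟨C, hC, hχ, hCV⟩ := compact_exists_isClopen_in_isOpen
    ((isOpen_dom g).isOpenMap_subtype_val _ (hV.preimage (continuous_sec g)))
    (⟨⟨χ, h⟩, ha, rfl⟩ : χ ∈ Subtype.val '' (sec g ⁻¹' V))
  refine ⟨g, C, hC, ⟨χ, hχ, h, rfl⟩, ?_⟩
  rintro _ ⟨ψ, hψ, h', rfl⟩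
  obtain ⟨ψ', h1, rfl⟩ := hCV hψ
  exact h1

/-- A compact subset of an open Hausdorff set is relatively closed in it. -/
theorem isOpen_diff_of_isCompact {Z : Type*} [TopologicalSpace Z] {V D : Set Z} (hV : IsOpen V)
    (hT : T2Space V) (hD : IsCompact D) (hDV : D ⊆ V) : IsOpen (V \ D) := by
  have h1 : IsCompact (Subtype.val ⁻¹' D : Set V) := by
    rw [Subtype.isCompact_iff, Subtype.image_preimage_coe, Set.inter_eq_self_of_subset_right hDV]
    exact hD
  have h2 := hV.isOpenMap_subtype_val _ h1.isClosed.isOpen_compl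
  rwa [← Set.preimage_compl, Subtype.image_preimage_coe] at h2

/-- On a bisection every function factors through the source. Extending by zero keeps continuity
because the base is clopen. -/
theorem exists_bisectionFun_eq {V : Set (GermGroupoid S)} {f : GermGroupoid S → ℂ}
    (hf : ContinuousOn f V) {g : LeftHull S} {C : Set (Omega S)} (hC : IsClopen C)
    (hV : germSet g C ⊆ V) : ∃ φ, bisectionFun g φ = (germSet g C).indicator f := by
  classical
  set C' := C ∩ {χ : Omega S | χ.val (dom g) = true}
  have hC' : IsClopen C' := hC.inter ⟨isClosed_dom g, isOpen_dom g⟩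
  let φ : Omega S → ℂ := fun χ => if h : χ ∈ C' then f (germ g χ h.2) else 0
  have hφ : Continuous φ := by
    have h1 : ContinuousOn φ C' := by
      rw [continuousOn_iff_continuous_domRestrict]
      have h2 : Continuous fun χ : C' => f (sec g ⟨χ.1, χ.2.2⟩) :=
        hf.comp_continuous ((continuous_sec g).comp (continuous_subtype_val.subtype_mk _))
          fun χ => hV ⟨χ.1, χ.2.1, χ.2.2, rfl⟩
      exact h2.congr fun χ => (show φ χ.1 = _ from dif_pos χ.2).symm
    have h3 : ContinuousOn φ C'ᶜ := continuousOn_const.congr fun χ hχ => dif_neg hχ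
    have h4 := h1.union_of_isOpen h3 hC'.isOpen hC'.compl.isOpen
    rwa [Set.union_compl_self, continuousOn_univ] at h4
  refine ⟨⟨φ, hφ⟩, funext fun a => ?_⟩
  by_cases ha : a ∈ germSet g C
  · rw [Set.indicator_of_mem ha]
    obtain ⟨χ, h1, h2, rfl⟩ := ha
    rw [bisectionFun, if_pos ⟨χ, trivial, h2, rfl⟩]
    exact dif_pos ⟨h1, h2⟩
  · rw [Set.indicator_of_notMem ha, bisectionFun]
    split_ifs with h
    · obtain ⟨χ, -, h2, rfl⟩ := h
      exact dif_neg fun h => ha ⟨χ, h.1, h2, rfl⟩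
    · rfl

/-- `C_c(𝒢(S))` is spanned by functions of the form `φ ∘ src` on `D(g)`. -/
theorem IsBasicCc.mem_span_bisectionFun {f : GermGroupoid S → ℂ} (hf : IsBasicCc f) :
    f ∈ Submodule.span ℂ {f | ∃ (g : LeftHull S) (φ : C(Omega S, ℂ)), bisectionFun g φ = f} := by
  classical
  obtain ⟨V, hVo, hVT, hfV, K, hK, hKV, hf0⟩ := hf
  -- The pieces of the finite cover are peeled off one at a time, so only continuity on V and the
  -- cover of the support are carried along.
  have key : ∀ (t : Finset (LeftHull S × Set (Omega S))),
      (∀ p ∈ t, IsClopen p.2 ∧ germSet p.1 p.2 ⊆ V) → ∀ f : GermGroupoid S → ℂ, ContinuousOn f V →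
      (∀ a, f a ≠ 0 → ∃ p ∈ t, a ∈ germSet p.1 p.2) →
      f ∈ Submodule.span ℂ
        {f | ∃ (g : LeftHull S) (φ : C(Omega S, ℂ)), bisectionFun g φ = f} := by
    intro t
    induction t using Finset.induction_on with
    | empty =>
      intro _ f _ h
      have : f = 0 := funext fun a => by
        by_contra hne
        obtain ⟨p, hp, -⟩ := h a hne
        simp at hp
      rw [this]
      exact zero_mem _
    | insert p t _ ih =>
      intro ht f hf h
      obtain ⟨hC, hCV⟩ := ht p (Finset.mem_insert_self _ _)
      set D := germSet p.1 p.2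
      have hD : IsOpen D := isOpen_germSet _ hC.isOpen
      have hVD : IsOpen (V \ D) :=
        isOpen_diff_of_isCompact hVo hVT (isCompact_germSet _ hC.isClosed) hCV
      rw [← Set.indicator_self_add_compl D f]
      refine add_mem (Submodule.subset_span ?_)
        (ih (fun q hq => ht q (Finset.mem_insert_of_mem hq)) _ ?_ ?_)
      · obtain ⟨φ, hφ⟩ := exists_bisectionFun_eq hf hC hCV
        exact ⟨p.1, φ, hφ⟩
      -- D and V \ D are both open, the latter because D is compact and V Hausdorff; the remainder
      -- vanishes on D and equals f on V \ D.
      · have h1 : ContinuousOn (Dᶜ.indicator f) D :=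
          continuousOn_const.congr fun a ha => Set.indicator_of_notMem (Set.notMem_compl_iff.2 ha) _
        have h2 : ContinuousOn (Dᶜ.indicator f) (V \ D) :=
          (hf.mono Set.sdiff_subset).congr fun a ha => Set.indicator_of_mem ha.2 _
        have h3 := h1.union_of_isOpen h2 hD hVD
        rwa [Set.union_sdiff_cancel hCV] at h3
      · intro a ha
        have haD : a ∈ Dᶜ := Set.mem_of_indicator_ne_zero ha
        rw [Set.indicator_of_mem haD] at ha
        obtain ⟨q, hq, haq⟩ := h a ha
        rcases Finset.mem_insert.1 hq with rfl | hq
        · exact absurd haq haD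
        · exact ⟨q, hq, haq⟩
  have hloc : ∀ a : V, ∃ p : LeftHull S × Set (Omega S), IsClopen p.2 ∧ a.1 ∈ germSet p.1 p.2 ∧
      germSet p.1 p.2 ⊆ V := fun a => by
    obtain ⟨g, C, h⟩ := exists_germSet_subset hVo a.2
    exact ⟨(g, C), h⟩
  choose p hp hap hpV using hloc
  obtain ⟨t, ht⟩ := hK.elim_finite_subcover (fun a => germSet (p a).1 (p a).2)
    (fun a => isOpen_germSet _ (hp a).isOpen) fun a ha => Set.mem_iUnion.2 ⟨⟨a, hKV ha⟩, hap _⟩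
  refine key (t.image p) (fun q hq => ?_) f hfV fun a ha => ?_
  · obtain ⟨a, -, rfl⟩ := Finset.mem_image.1 hq
    exact ⟨hp a, hpV a⟩
  · have haK : a ∈ K := by
      by_contra h
      exact ha (hf0 a h)
    obtain ⟨b, hb, hab⟩ := Set.mem_iUnion₂.1 (ht haK)
    exact ⟨p b, Finset.mem_image_of_mem p hb, hab⟩

theorem regularFamily_mem (f : Cc (GermGroupoid S)) :
    regularFamily f ∈ (indicatorSpan (S := S)).topologicalClosure := by
  have h1 : (f : GermGroupoid S → ℂ) ∈ Submodule.span ℂ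
      {f | ∃ (g : LeftHull S) (φ : C(Omega S, ℂ)), bisectionFun g φ = f} :=
    Submodule.span_le.2 (fun _ hf => IsBasicCc.mem_span_bisectionFun hf) f.2
  -- Membership in `Cc` is part of the induction claim, since the linear map is only defined there.
  have key : ∀ f ∈ Submodule.span ℂ
      {f | ∃ (g : LeftHull S) (φ : C(Omega S, ℂ)), bisectionFun g φ = f},
      ∃ hf : f ∈ Cc (GermGroupoid S), regularFamilyₗ (GermGroupoid S) ⟨f, hf⟩ ∈
        (indicatorSpan (S := S)).topologicalClosure := by
    intro f hf
    induction hf using Submodule.span_induction with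
    | zero => exact ⟨zero_mem _, (map_zero (regularFamilyₗ (GermGroupoid S))).symm ▸ zero_mem _⟩
    | add x y _ _ hx hy =>
      obtain ⟨hx, hx'⟩ := hx
      obtain ⟨hy, hy'⟩ := hy
      refine ⟨add_mem hx hy, ?_⟩
      have := map_add (regularFamilyₗ (GermGroupoid S)) ⟨x, hx⟩ ⟨y, hy⟩
      exact (congrArg (· ∈ (indicatorSpan (S := S)).topologicalClosure) this).mpr (add_mem hx' hy')
    | smul c x _ hx =>
      obtain ⟨hx, hx'⟩ := hx
      refine ⟨Submodule.smul_mem _ c hx, ?_⟩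
      have := map_smul (regularFamilyₗ (GermGroupoid S)) c ⟨x, hx⟩
      exact (congrArg (· ∈ (indicatorSpan (S := S)).topologicalClosure) this).mpr
        (SMulMemClass.smul_mem c hx')
    | mem x hx =>
      obtain ⟨g, φ, rfl⟩ := hx
      exact ⟨_, regularFamily_bisectionCc_mem g φ⟩
  exact (key _ h1).2

/-- It reduces closed conditions on C*_r(𝒢(S)) to finite combinations of indicators. -/
theorem reducedGroupoidAlgebra_le :
    reducedGroupoidAlgebra (GermGroupoid S) ≤ (indicatorSpan (S := S)).topologicalClosure := by
  refine NonUnitalStarSubalgebra.topologicalClosure_minimal _ ?_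
    (NonUnitalStarSubalgebra.isClosed_topologicalClosure _)
  refine NonUnitalStarAlgebra.adjoin_le ?_
  rintro _ ⟨f, rfl⟩
  exact regularFamily_mem f

theorem indicatorElem_mem (g : LeftHull S) :
    indicatorElem g ∈ reducedGroupoidAlgebra (GermGroupoid S) :=
  (toReduced (GermGroupoid S) (bisectionCc g 1)).2

end Partition

/-! ### The norm is attained at χ_e -/

section NormEstimate

variable {S : Type*} [LeftCancelMonoid S]

/-- A finitely supported test vector over χ is replaced by one over χ_e, each [h_k,χ] becoming [h_k
s,χ_e] for a generic s. Neither its norm nor that of its image under a changes. -/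
theorem IsCStarRegular.norm_eval_le (hS : IsCStarRegular S) (χ : Omega S)
    {a : OpProduct (SrcFiber (GermGroupoid S) : Omega S → Type _)} (ha : a ∈ indicatorSpan) :
    ‖OpProduct.eval χ a‖ ≤ ‖OpProduct.eval (Omega.point 1) a‖ := by
  classical
  obtain ⟨c, rfl⟩ := Finsupp.mem_span_range_iff_exists_finsupp.1 (mem_indicatorSpan.1 ha)
  refine opNorm_le_of_finite (norm_nonneg _) fun I z => ?_
  choose h hh using fun k : SrcFiber (GermGroupoid S) χ => exists_germOpt k
  -- The point s has to separate the germs occurring in the vector and those occurring in its image.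
  obtain ⟨s, hs0, hs⟩ := hS.exists_generic χ
    (I.image h ∪ (c.support ×ˢ I).image fun p => p.1.comp (h p.2))
  have hI : ∀ k ∈ I, h k ∈ I.image h ∪ (c.support ×ˢ I).image fun p => p.1.comp (h p.2) :=
    fun k hk => Finset.mem_union_left _ (Finset.mem_image_of_mem _ hk)
  have hcI : ∀ p ∈ c.support ×ˢ I, p.1.comp (h p.2) ∈
      I.image h ∪ (c.support ×ˢ I).image fun p => p.1.comp (h p.2) :=
    fun p hp => Finset.mem_union_right _ (Finset.mem_image_of_mem (fun p => p.1.comp (h p.2)) hp)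
  -- Composing with the translation by s turns evaluation at e into evaluation at s.
  have happ : ∀ g : LeftHull S, (g.comp (LeftHull.ofElem s)).1 1 = g.1 s := fun g => by
    rw [comp_apply, ofElem_apply, mul_one]
    rfl
  -- The expansion is used twice: over χ with the representatives h_k, and over χ_e with h_k s.
  have hexp : ∀ (ψ : Omega S) (m : SrcFiber (GermGroupoid S) χ → LeftHull S),
      OpProduct.eval ψ (c.sum fun g r => r • indicatorElem g)
        (∑ k ∈ I, z k • deltaOpt (germOpt ψ (m k))) =
      ∑ p ∈ c.support ×ˢ I, (c p.1 * z p.2) • deltaOpt (germOpt ψ (p.1.comp (m p.2))) := by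
    intro ψ m
    rw [Finset.sum_product, Finsupp.sum, map_sum (OpProduct.eval ψ), sum_apply]
    refine Finset.sum_congr rfl fun g _ => ?_
    rw [map_smul, smul_apply, map_sum, Finset.smul_sum]
    refine Finset.sum_congr rfl fun k _ => ?_
    rw [map_smul, eval_indicatorElem_deltaOpt, smul_smul]
  have e1 : ∑ k ∈ I, z k • delta k = ∑ k ∈ I, z k • deltaOpt (germOpt χ (h k)) :=
    Finset.sum_congr rfl fun k _ => by rw [hh, deltaOpt_some]
  have n1 : ‖∑ k ∈ I, z k • deltaOpt (germOpt χ (h k))‖ = ‖∑ k ∈ I, z k •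
      deltaOpt (germOpt (Omega.point 1) ((h k).comp (LeftHull.ofElem s)))‖ := by
    refine norm_sum_deltaOpt I z _ _ (fun k hk l hl => ?_) fun k hk => ?_
    · rw [germOpt_point_one_eq_iff, happ, happ, hs _ (hI k hk) _ (hI l hl)]
    · rw [germOpt_point_one_eq_none_iff, happ, hs0 _ (hI k hk)]
  have happ' : ∀ g g' : LeftHull S,
      (g.comp (g'.comp (LeftHull.ofElem s))).1 1 = (g.comp g').1 s := fun g g' => by
    rw [comp_apply, happ, comp_apply]
  have n2 : ‖∑ p ∈ c.support ×ˢ I, (c p.1 * z p.2) • deltaOpt (germOpt χ (p.1.comp (h p.2)))‖ =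
      ‖∑ p ∈ c.support ×ˢ I, (c p.1 * z p.2) • deltaOpt (germOpt (Omega.point 1)
        (p.1.comp ((h p.2).comp (LeftHull.ofElem s))))‖ := by
    refine norm_sum_deltaOpt _ _ _ _ (fun p hp q hq => ?_) fun p hp => ?_
    · rw [germOpt_point_one_eq_iff, happ', happ', hs _ (hcI p hp) _ (hcI q hq)]
    · rw [germOpt_point_one_eq_none_iff, happ', hs0 _ (hcI p hp)]
  rw [e1, hexp χ h, n1, n2, ← hexp (Omega.point 1) fun k => (h k).comp (LeftHull.ofElem s)]
  exact ContinuousLinearMap.le_opNorm _ _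

/-- The supremum over χ is bounded by the value at χ_e on combinations of indicators, and this is a
closed condition. -/
theorem IsCStarRegular.norm_eval_eq (hS : IsCStarRegular S)
    {a : OpProduct (SrcFiber (GermGroupoid S) : Omega S → Type _)}
    (ha : a ∈ reducedGroupoidAlgebra (GermGroupoid S)) :
    ‖OpProduct.eval (Omega.point 1) a‖ = ‖a‖ := by
  refine le_antisymm (OpProduct.norm_eval_le _ a) ?_
  have hcont : Continuous fun a : OpProduct (SrcFiber (GermGroupoid S) : Omega S → Type _) =>
      OpProduct.eval (Omega.point 1) a :=
    AddMonoidHomClass.continuous_of_bound (OpProduct.eval (Omega.point 1)) 1 fun a => by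
      rw [one_mul]
      exact OpProduct.norm_eval_le _ a
  have hmem : a ∈ closure (indicatorSpan (S := S) : Set _) := reducedGroupoidAlgebra_le ha
  refine closure_minimal (t := {a | ‖a‖ ≤ ‖OpProduct.eval (Omega.point 1) a‖}) (fun b hb => ?_)
    (isClosed_le continuous_norm hcont.norm) hmem
  exact OpProduct.norm_le (norm_nonneg _) fun χ => hS.norm_eval_le χ hb

end NormEstimate

/-! ### Identification of the image with C*_r(S) -/

section Comparison

variable {S : Type*} [LeftCancelMonoid S]

/-- The representation `a ↦ U* ρ_{χ_e}(a) U` on `ℓ²(S)`. -/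
noncomputable def conjRep (U : L2 S ≃ₗᵢ[ℂ] L2 (SrcFiber (GermGroupoid S) (Omega.point 1))) :
    OpProduct (SrcFiber (GermGroupoid S) : Omega S → Type _) →⋆ₙₐ[ℂ] (L2 S →L[ℂ] L2 S) :=
  (NonUnitalStarAlgHomClass.toNonUnitalStarAlgHom U.symm.conjStarAlgEquiv).comp
    (OpProduct.eval (Omega.point 1))

theorem conjRep_apply (U : L2 S ≃ₗᵢ[ℂ] L2 (SrcFiber (GermGroupoid S) (Omega.point 1)))
    (a : OpProduct (SrcFiber (GermGroupoid S) : Omega S → Type _)) (ξ : L2 S) :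
    conjRep U a ξ = U.symm (OpProduct.eval (Omega.point 1) a (U ξ)) := rfl

theorem norm_conjRep (U : L2 S ≃ₗᵢ[ℂ] L2 (SrcFiber (GermGroupoid S) (Omega.point 1)))
    (a : OpProduct (SrcFiber (GermGroupoid S) : Omega S → Type _)) :
    ‖conjRep U a‖ = ‖OpProduct.eval (Omega.point 1) a‖ := by
  refine le_antisymm (ContinuousLinearMap.opNorm_le_bound _ (norm_nonneg _) fun ξ => ?_)
    (ContinuousLinearMap.opNorm_le_bound _ (norm_nonneg _) fun ξ => ?_)
  · rw [conjRep_apply, LinearIsometryEquiv.norm_map]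
    exact (ContinuousLinearMap.le_opNorm _ _).trans_eq (by rw [LinearIsometryEquiv.norm_map])
  · have h := ContinuousLinearMap.le_opNorm (conjRep U a) (U.symm ξ)
    rwa [conjRep_apply, LinearIsometryEquiv.norm_map, LinearIsometryEquiv.norm_map,
      LinearIsometryEquiv.apply_symm_apply] at h

variable {U : L2 S ≃ₗᵢ[ℂ] L2 (SrcFiber (GermGroupoid S) (Omega.point 1))}

theorem continuous_conjRep : Continuous (conjRep U) :=
  AddMonoidHomClass.continuous_of_bound (conjRep U) 1 fun a => by
    rw [one_mul, norm_conjRep]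
    exact OpProduct.norm_eval_le _ a

/-- Both operators move the basis alike: 1_{D(s)} sends [t,χ_e] to [st,χ_e]. -/
theorem conjRep_indicatorElem_ofElem (hU : ∀ s, U (delta s) = delta (baseArrow s)) (s : S) :
    conjRep U (indicatorElem (LeftHull.ofElem s)) = leftRegular s :=
  clm_ext_delta fun t => by
    have h : germOpt (Omega.point 1) ((LeftHull.ofElem s).comp (LeftHull.ofElem t)) =
        some (baseArrow (s * t)) := by
      rw [germOpt_point_one_eq_some_iff, comp_apply, ofElem_apply, mul_one]
      rfl
    rw [conjRep_apply, hU, leftRegular_delta, ← deltaOpt_some, ← germOpt_ofElem,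
      eval_indicatorElem_deltaOpt, h, deltaOpt_some, ← hU, LinearIsometryEquiv.symm_apply_apply]

theorem conjRep_indicatorElem_mem (hU : ∀ s, U (delta s) = delta (baseArrow s))
    {g : S ≃. S} (hg : InLeftHull g) :
    conjRep U (indicatorElem ⟨g, hg⟩) ∈
      StarAlgebra.adjoin ℂ (Set.range (leftRegular (S := S))) := by
  induction hg with
  | translation s =>
    exact (conjRep_indicatorElem_ofElem hU s).symm ▸ StarAlgebra.subset_adjoin _ _ ⟨s, rfl⟩
  | @trans g h hg hh ihg ihh =>
    -- The factors are swapped because `g.trans h` applies `g` first.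
    have : conjRep U (indicatorElem ⟨g.trans h, hg.trans hh⟩) =
        conjRep U (indicatorElem ⟨h, hh⟩) * conjRep U (indicatorElem ⟨g, hg⟩) :=
      (congrArg (conjRep U) (indicatorElem_comp (⟨h, hh⟩ : LeftHull S) ⟨g, hg⟩)).trans
        (map_mul (conjRep U) _ _)
    rw [this]
    exact mul_mem ihh ihg
  | @symm g hg ih =>
    have : conjRep U (indicatorElem ⟨g.symm, hg.symm⟩) =
        star (conjRep U (indicatorElem ⟨g, hg⟩)) :=
      (congrArg (conjRep U) (indicatorElem_inv (⟨g, hg⟩ : LeftHull S))).trans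
        (map_star (conjRep U) _)
    rw [this]
    exact star_mem ih

theorem conjRep_mem (hU : ∀ s, U (delta s) = delta (baseArrow s))
    {a : OpProduct (SrcFiber (GermGroupoid S) : Omega S → Type _)}
    (ha : a ∈ reducedGroupoidAlgebra (GermGroupoid S)) :
    conjRep U a ∈ reducedSemigroupAlgebra S := by
  have hmem : a ∈ closure (indicatorSpan (S := S) : Set _) := reducedGroupoidAlgebra_le ha
  refine map_mem_closure continuous_conjRep hmem fun b hb => ?_
  change b ∈ Submodule.span ℂ _ at hb
  change conjRep U b ∈ StarAlgebra.adjoin ℂ (Set.range (leftRegular (S := S)))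
  induction hb using Submodule.span_induction with
  | zero => rw [map_zero]; exact zero_mem _
  | add x y _ _ hx hy => rw [map_add]; exact add_mem hx hy
  | smul c x _ hx => rw [map_smul]; exact SMulMemClass.smul_mem c hx
  | mem x hx =>
    obtain ⟨g, rfl⟩ := hx
    exact conjRep_indicatorElem_mem hU g.2

theorem leftRegular_one : leftRegular (1 : S) = 1 :=
  clm_ext_delta fun t => by
    rw [leftRegular_delta, one_mul]
    rfl

/-- An isometric image of a complete space is closed, so it suffices to reach the *-algebra
generated by the λ_s. -/
theorem IsCStarRegular.exists_conjRep_eq (hS : IsCStarRegular S)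
    (hU : ∀ s, U (delta s) = delta (baseArrow s)) {T : L2 S →L[ℂ] L2 S}
    (hT : T ∈ reducedSemigroupAlgebra S) :
    ∃ a : reducedGroupoidAlgebra (GermGroupoid S), conjRep U a.1 = T := by
  have hcomp : CompleteSpace (reducedGroupoidAlgebra (GermGroupoid S)) :=
    IsClosed.completeSpace_coe (hs := NonUnitalStarSubalgebra.isClosed_topologicalClosure _)
  have hiso : Isometry fun a : reducedGroupoidAlgebra (GermGroupoid S) => conjRep U a.1 :=
    Isometry.of_dist_eq fun a b => by
      rw [dist_eq_norm, ← map_sub, norm_conjRep, hS.norm_eval_eq (sub_mem a.2 b.2),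
        Subtype.dist_eq, dist_eq_norm]
  refine closure_minimal (t := Set.range fun a : reducedGroupoidAlgebra (GermGroupoid S) =>
    conjRep U a.1) (fun A hA => ?_) hiso.isClosedEmbedding.isClosed_range hT
  change A ∈ StarAlgebra.adjoin ℂ (Set.range (leftRegular (S := S))) at hA
  have hleft : ∀ s : S, ∃ a : reducedGroupoidAlgebra (GermGroupoid S),
      conjRep U a.1 = leftRegular s := fun s =>
    ⟨⟨_, indicatorElem_mem (LeftHull.ofElem s)⟩, conjRep_indicatorElem_ofElem hU s⟩
  induction hA using StarAlgebra.adjoin_induction with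
  | mem A hA =>
    obtain ⟨s, rfl⟩ := hA
    exact hleft s
  -- The groupoid algebra is treated as non-unital, so scalars are obtained from λ_e = 1.
  | algebraMap c =>
    obtain ⟨a, ha⟩ := hleft 1
    refine ⟨c • a, ?_⟩
    rw [Algebra.algebraMap_eq_smul_one, ← leftRegular_one, ← ha]
    exact map_smul (conjRep U) c a.1
  | add A B _ _ hA hB =>
    obtain ⟨a, rfl⟩ := hA
    obtain ⟨b, rfl⟩ := hB
    exact ⟨a + b, map_add (conjRep U) a.1 b.1⟩
  | mul A B _ _ hA hB =>
    obtain ⟨a, rfl⟩ := hA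
    obtain ⟨b, rfl⟩ := hB
    exact ⟨a * b, map_mul (conjRep U) a.1 b.1⟩
  | star A _ hA =>
    obtain ⟨a, rfl⟩ := hA
    exact ⟨star a, map_star (conjRep U) a.1⟩

theorem IsCStarRegular.exists_starAlgEquiv (hS : IsCStarRegular S)
    (hU : ∀ s, U (delta s) = delta (baseArrow s)) :
    ∃ Φ : reducedGroupoidAlgebra (GermGroupoid S) ≃⋆ₐ[ℂ] reducedSemigroupAlgebra S,
      ∀ a, (Φ a : L2 S →L[ℂ] L2 S) = conjRep U a.1 := by
  let f : reducedGroupoidAlgebra (GermGroupoid S) →⋆ₙₐ[ℂ] reducedSemigroupAlgebra S :=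
    { toFun a := ⟨conjRep U a.1, conjRep_mem hU a.2⟩
      map_smul' c a := Subtype.ext (map_smul (conjRep U) c a.1)
      map_zero' := Subtype.ext (map_zero (conjRep U))
      map_add' a b := Subtype.ext (map_add (conjRep U) a.1 b.1)
      map_mul' a b := Subtype.ext (map_mul (conjRep U) a.1 b.1)
      map_star' a := Subtype.ext (map_star (conjRep U) a.1) }
  refine ⟨StarAlgEquiv.ofBijective f ⟨fun a b h => ?_, fun T => ?_⟩, fun a => rfl⟩
  · have h1 : conjRep U (a.1 - b.1) = 0 := by
      rw [map_sub, sub_eq_zero]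
      exact congrArg Subtype.val h
    rw [← norm_eq_zero, norm_conjRep, hS.norm_eval_eq (sub_mem a.2 b.2), norm_eq_zero] at h1
    exact Subtype.ext (sub_eq_zero.1 h1)
  · obtain ⟨a, ha⟩ := hS.exists_conjRep_eq hU T.2
    exact ⟨a, Subtype.ext ha⟩

end Comparison

end SemigroupCStar

theorem proposition2p10 {S : Type*} [LeftCancelMonoid S]
    (hS : SemigroupCStar.IsCStarRegular S) :
    ∃ U : SemigroupCStar.L2 S ≃ₗᵢ[ℂ] SemigroupCStar.L2
        (SemigroupCStar.SrcFiber (SemigroupCStar.GermGroupoid S) (SemigroupCStar.Omega.point 1)),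
      (∀ s, U (SemigroupCStar.delta s) = SemigroupCStar.delta (SemigroupCStar.baseArrow s)) ∧
      ∃ Φ : SemigroupCStar.reducedGroupoidAlgebra (SemigroupCStar.GermGroupoid S) ≃⋆ₐ[ℂ]
          SemigroupCStar.reducedSemigroupAlgebra S,
        ∀ (a : SemigroupCStar.reducedGroupoidAlgebra (SemigroupCStar.GermGroupoid S))
          (ξ : SemigroupCStar.L2 S),
          U ((Φ a : SemigroupCStar.L2 S →L[ℂ] SemigroupCStar.L2 S) ξ) =
            SemigroupCStar.rhoReduced (SemigroupCStar.GermGroupoid S)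
              (SemigroupCStar.Omega.point 1) a (U ξ) := by
  obtain ⟨U, hU⟩ := SemigroupCStar.exists_unitary_of_equiv
    (Equiv.ofBijective _ (SemigroupCStar.baseArrow_bijective (S := S)))
  obtain ⟨Φ, hΦ⟩ := hS.exists_starAlgEquiv hU
  refine ⟨U, hU, Φ, fun a ξ => ?_⟩
  rw [hΦ, SemigroupCStar.conjRep_apply, LinearIsometryEquiv.apply_symm_apply]
  rfl
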